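/- All Hilbert spaces are finite-dimensional. For a density operator (positive semidefinite, unit trace) $\rho$ and a positive semidefinite operator $\sigma$, let $D(\rho\Vert\sigma)=\operatorname{Tr}\{\rho[\log\rho-\log\sigma]\}$ if $\operatorname{supp}(\rho)\subseteq\operatorname{supp}(\sigma)$ and $D(\rho\Vert\sigma)=+\infty$ otherwise (natural logarithm, taken on the support). For positive semidefinite operators let $F(\tau,\varsigma)=\Vert\sqrt{\tau}\sqrt{\varsigma}\Vert_1^2$ be the fidelity and $D_B^2(\tau,\varsigma)=2(1-\sqrt{F(\tau,\varsigma)})$ the squared Bures distance. Subscripts denote partial traces, e.g. $\rho_B=\operatorname{Tr}_A\rho_{AB}$, and identity tensor factors are suppressed in operator products. Let $H(A|B)_\rho=-D(\rho_{AB}\Vert I_A\otimes\rho_B)$ and $I(A;B|C)_\omega=D(\omega_{ABC}\Vert\omega_{AC}\otimes I_B)-D(\omega_{BC}\Vert\omega_C\otimes I_B)$. **Theorem.** The following five statements are equivalent (it is not claimed that any of them is true). 1. (Strong subadditivity) For all finite-dimensional systems $A,B,C$ and every density operator $\omega_{ABC}$ such that $\omega_C$ is positive definite, $$I(A;B|C)_\omega\ge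 D_B^2\bigl(\omega_{ABC},\ \omega_{AC}^{1/2}\omega_C^{-1/2}\,\omega_{BC}\,\omega_C^{-1/2}\omega_{AC}^{1/2}\bigr).$$ 2. (Concavity of conditional entropy) For all finite-dimensional systems $A,B$, every probability distribution $p$ on a finite set $X$ and all density operators $\rho^x_{AB}$ ($x\in X$) such that, with $\overline\rho_{AB}=\sum_x p(x)\rho^x_{AB}$, the operator $\overline\rho_B$ is positive definite, $$H(A|B)_{\overline\rho}-\sum_x p(x)H(A|B)_{\rho^x}\ge\sum_x p(x)\,D_B^2\bigl(\rho^x_{AB},\ \overline\rho_{AB}^{1/2}\overline\rho_B^{-1/2}\rho^x_B\,\overline\rho_B^{-1/2}\overline\rho_{AB}^{1/2}\bigr).$$ 3. (Monotonicity of relative entropy under partial trace) For all finite-dimensional systems $A,B$ and all density operators $\rho_{AB},\sigma_{AB}$ such that $\operatorname{supp}(\rho_{AB})\subseteq\operatorname{supp}(\sigma_{AB})$ and $\sigma_B$ is positive definite, $$D(\rho_{AB}\Vert\sigma_{AB})-D(\rho_B\Vert\sigma_B)\ge D_B^2\bigl(\rho_{AB},\ \sigma_{AB}^{1/2}\sigma_B^{-1/2}\rho_B\,\sigma_B^{-1/2}\sigma_{AB}^{1/2}\bigr).$$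 4. (Joint convexity of relative entropy) For every finite-dimensional system, every probability distribution $p$ on a finite set $X$ and all density operators $\rho_x,\sigma_x$ ($x\in X$) with $\operatorname{supp}(\rho_x)\subseteq\operatorname{supp}(\sigma_x)$ such that, with $\overline\rho=\sum_x p(x)\rho_x$ and $\overline\sigma=\sum_x p(x)\sigma_x$, the operator $\overline\sigma$ is positive definite, $$\sum_x p(x)D(\rho_x\Vert\sigma_x)-D(\overline\rho\Vert\overline\sigma)\ge\sum_x p(x)\,D_B^2\bigl(\rho_x,\ \sigma_x^{1/2}\,\overline\sigma^{-1/2}\,\overline\rho\,\overline\sigma^{-1/2}\sigma_x^{1/2}\bigr).$$ 5. (Monotonicity of relative entropy under channels) For all finite-dimensional systems $S,B$, all density operators $\rho,\sigma$ on $S$ with $\operatorname{supp}(\rho)\subseteq\operatorname{supp}(\sigma)$ and every completely positive trace preserving map $\mathcal N$ from operators on $S$ to operators on $B$ such that $\mathcal N(\sigma)$ is positive definite, $$D(\rho\Vert\sigma)-D(\mathcal N(\rho)\Vert\mathcal N(\sigma))\ge D_B^2\Bigl(\rho,\ \sigma^{1/2}\mathcal N^\dagger\bigl(\mathcal N(\sigma)^{-1/2}\,\mathcal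 N(\rho)\,\mathcal N(\sigma)^{-1/2}\bigr)\sigma^{1/2}\Bigr),$$ where $\mathcal N^\dagger$ is the adjoint of $\mathcal N$ for the Hilbert--Schmidt inner product $\langle X,Y\rangle=\operatorname{Tr}\{X^\dagger Y\}$. -/

import Mathlib

open scoped Kronecker Matrix ComplexOrder

universe u

namespace PetzRemainder

noncomputable section

/-! Operators on a finite-dimensional Hilbert space are complex matrices indexed by a finite type
(an orthonormal basis); the tensor product of two spaces is indexed by the product type. -/

/-- A density operator: positive semidefinite with unit trace. -/
def IsDensity {n : Type u} [Fintype n] (ρ : Matrix n n ℂ) : Prop :=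
  ρ.PosSemidef ∧ ρ.trace = 1

/-- The support of a positive semidefinite operator, that is, its range (equivalently, the
orthogonal complement of its kernel). -/
def supp {n : Type u} [Fintype n] (M : Matrix n n ℂ) : Submodule ℂ (n → ℂ) :=
  LinearMap.range M.mulVecLin

/-- The square root `M ^ (1/2)` of a positive semidefinite operator. -/
def msqrt {n : Type u} [Fintype n] [DecidableEq n] (M : Matrix n n ℂ) : Matrix n n ℂ :=
  cfc Real.sqrt M

/-- The inverse square root `M ^ (-1/2)` of a positive definite operator. -/
def minvsqrt {n : Type u} [Fintype n] [DecidableEq n] (M : Matrix n n ℂ) : Matrix n n ℂ :=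
  cfc (fun x : ℝ => (Real.sqrt x)⁻¹) M

/-- The logarithm of a positive semidefinite operator, taken on its support (and zero on its
kernel, as `Real.log 0 = 0`). -/
def mlog {n : Type u} [Fintype n] [DecidableEq n] (M : Matrix n n ℂ) : Matrix n n ℂ :=
  cfc Real.log M

open Classical in
/-- The Umegaki relative entropy `D(ρ‖σ)`: it is `Tr {ρ (log ρ - log σ)}` if
`supp ρ ⊆ supp σ`, and `+∞` otherwise. -/
def relEntropy {n : Type u} [Fintype n] [DecidableEq n] (ρ σ : Matrix n n ℂ) : EReal :=
  if supp ρ ≤ supp σ then (((ρ * (mlog ρ - mlog σ)).trace.re : ℝ) : EReal) else ⊤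

/-- The trace norm `‖M‖₁ = Tr {(M† M) ^ (1/2)}`. -/
def traceNorm {n : Type u} [Fintype n] [DecidableEq n] (M : Matrix n n ℂ) : ℝ :=
  (msqrt (Mᴴ * M)).trace.re

/-- The quantum fidelity `F(τ, ς) = ‖√τ √ς‖₁ ^ 2` of positive semidefinite operators. -/
def fidelity {n : Type u} [Fintype n] [DecidableEq n] (τ ς : Matrix n n ℂ) : ℝ :=
  traceNorm (msqrt τ * msqrt ς) ^ 2

/-- The square of the Bures distance, `2 (1 - √F)`. -/
def buresSq {n : Type u} [Fintype n] [DecidableEq n] (τ ς : Matrix n n ℂ) : ℝ :=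
  2 * (1 - Real.sqrt (fidelity τ ς))

/-- The partial trace over the left tensor factor, `M_{AB} ↦ M_B = Tr_A M_{AB}`. -/
def trLeft {A B : Type u} [Fintype A] (M : Matrix (A × B) (A × B) ℂ) : Matrix B B ℂ :=
  Matrix.of fun b b' => ∑ a, M (a, b) (a, b')

/-- The partial trace over the middle tensor factor, `M_{ABC} ↦ M_{AC} = Tr_B M_{ABC}`. -/
def trMiddle {A B C : Type u} [Fintype B] (M : Matrix (A × B × C) (A × B × C) ℂ) :
    Matrix (A × C) (A × C) ℂ :=
  Matrix.of fun x y => ∑ b, M (x.1, b, x.2) (y.1, b, y.2)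

/-- The operator `M_{AC} ⊗ I_B` on `A ⊗ B ⊗ C`, for `M_{AC}` acting on `A ⊗ C`. -/
def tensorIdMiddle {A C : Type u} (B : Type u) [DecidableEq B]
    (M : Matrix (A × C) (A × C) ℂ) : Matrix (A × B × C) (A × B × C) ℂ :=
  Matrix.of fun x y => M (x.1, x.2.2) (y.1, y.2.2) * (1 : Matrix B B ℂ) x.2.1 y.2.1

/-- The conditional mutual information
`I(A;B|C) = D(ω_{ABC} ‖ ω_{AC} ⊗ I_B) - D(ω_{BC} ‖ ω_C ⊗ I_B)`. -/
def condMutualInfo {A B C : Type u} [Fintype A] [DecidableEq A] [Fintype B] [DecidableEq B]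
    [Fintype C] [DecidableEq C] (ω : Matrix (A × B × C) (A × B × C) ℂ) : EReal :=
  relEntropy ω (tensorIdMiddle B (trMiddle ω)) -
    relEntropy (trLeft ω) ((1 : Matrix B B ℂ) ⊗ₖ trLeft (trLeft ω))

/-- The conditional entropy `H(A|B) = -D(σ_{AB} ‖ I_A ⊗ σ_B)`. -/
def condEntropy {A B : Type u} [Fintype A] [DecidableEq A] [Fintype B] [DecidableEq B]
    (σ : Matrix (A × B) (A × B) ℂ) : EReal :=
  -relEntropy σ ((1 : Matrix A A ℂ) ⊗ₖ trLeft σ)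

/-- The operator `ω_{AC}^{1/2} ω_C^{-1/2} Y_{BC} ω_C^{-1/2} ω_{AC}^{1/2}` on `A ⊗ B ⊗ C`: the
Petz recovery map `C → AC` of `ω`, applied to the `C` system of an operator `Y` on `B ⊗ C`. -/
def petzCtoAC {A B C : Type u} [Fintype A] [DecidableEq A] [Fintype B] [DecidableEq B]
    [Fintype C] [DecidableEq C] (ω : Matrix (A × B × C) (A × B × C) ℂ)
    (Y : Matrix (B × C) (B × C) ℂ) : Matrix (A × B × C) (A × B × C) ℂ :=
  let ωAC := trMiddle ω
  let ωC := trLeft (trLeft ω)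
  let K := (1 : Matrix B B ℂ) ⊗ₖ minvsqrt ωC
  tensorIdMiddle B (msqrt ωAC) * ((1 : Matrix A A ℂ) ⊗ₖ (K * Y * K)) *
    tensorIdMiddle B (msqrt ωAC)

/-- The Petz recovery map of `σ_{AB}` and `Tr_A`:
`Y_B ↦ σ_{AB}^{1/2} σ_B^{-1/2} Y_B σ_B^{-1/2} σ_{AB}^{1/2}`. -/
def petzPartialTrace {A B : Type u} [Fintype A] [DecidableEq A] [Fintype B] [DecidableEq B]
    (σ : Matrix (A × B) (A × B) ℂ) (Y : Matrix B B ℂ) : Matrix (A × B) (A × B) ℂ :=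
  msqrt σ * ((1 : Matrix A A ℂ) ⊗ₖ (minvsqrt (trLeft σ) * Y * minvsqrt (trLeft σ))) * msqrt σ

/-- The ampliation `id_k ⊗ N`, applied to an operator `M` on `ℂ^k ⊗ S`. -/
def ampliate {S B : Type u} (N : Matrix S S ℂ →ₗ[ℂ] Matrix B B ℂ) (k : ℕ)
    (M : Matrix (Fin k × S) (Fin k × S) ℂ) : Matrix (Fin k × B) (Fin k × B) ℂ :=
  Matrix.of fun x y => N (Matrix.of fun s s' => M (x.1, s) (y.1, s')) x.2 y.2

/-- A quantum channel: a completely positive and trace preserving linear map. -/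
structure IsCPTP {S B : Type u} [Fintype S] [Fintype B]
    (N : Matrix S S ℂ →ₗ[ℂ] Matrix B B ℂ) : Prop where
  completelyPositive : ∀ (k : ℕ) (M : Matrix (Fin k × S) (Fin k × S) ℂ),
    M.PosSemidef → (ampliate N k M).PosSemidef
  tracePreserving : ∀ M : Matrix S S ℂ, (N M).trace = M.trace

/-- The adjoint `N†` of `N` for the Hilbert-Schmidt inner product `⟨X, Y⟩ = Tr {X† Y}`; its
`(i, j)` entry is `⟨E_ij, N† Y⟩ = ⟨N E_ij, Y⟩` for the matrix unit `E_ij`. -/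
def hsAdjoint {S B : Type u} [DecidableEq S] [Fintype B]
    (N : Matrix S S ℂ →ₗ[ℂ] Matrix B B ℂ) (Y : Matrix B B ℂ) : Matrix S S ℂ :=
  Matrix.of fun i j => ((N (Matrix.single i j 1))ᴴ * Y).trace

/-- The defining property of the adjoint: `⟨X, N† Y⟩ = ⟨N X, Y⟩`. -/
theorem trace_mul_hsAdjoint {S B : Type u} [Fintype S] [DecidableEq S] [Fintype B]
    (N : Matrix S S ℂ →ₗ[ℂ] Matrix B B ℂ) (X : Matrix S S ℂ) (Y : Matrix B B ℂ) :
    (Xᴴ * hsAdjoint N Y).trace = ((N X)ᴴ * Y).trace := by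
  have hX : N X = ∑ i, ∑ j, X i j • N (Matrix.single i j 1) := by
    conv_lhs => rw [Matrix.matrix_eq_sum_single X]
    simp only [map_sum]
    refine Finset.sum_congr rfl fun i _ => Finset.sum_congr rfl fun j _ => ?_
    rw [← map_smul, Matrix.smul_single, smul_eq_mul, mul_one]
  rw [hX]
  simp only [Matrix.conjTranspose_sum, Matrix.conjTranspose_smul, Finset.sum_mul,
    Matrix.trace_sum, Matrix.smul_mul, Matrix.trace_smul, smul_eq_mul]
  rw [Finset.sum_comm, Matrix.trace]
  simp only [Matrix.diag_apply, Matrix.mul_apply, Matrix.conjTranspose_apply]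
  rfl

/-- The Petz recovery map of `σ` and `N`:
`Y ↦ σ^{1/2} N†(N(σ)^{-1/2} Y N(σ)^{-1/2}) σ^{1/2}`. -/
def petz {S B : Type u} [Fintype S] [DecidableEq S] [Fintype B] [DecidableEq B]
    (σ : Matrix S S ℂ) (N : Matrix S S ℂ →ₗ[ℂ] Matrix B B ℂ) (Y : Matrix B B ℂ) :
    Matrix S S ℂ :=
  msqrt σ * hsAdjoint N (minvsqrt (N σ) * Y * minvsqrt (N σ)) * msqrt σ

/-- A probability distribution on a finite alphabet. -/
def IsProb {X : Type u} [Fintype X] (p : X → ℝ) : Prop :=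
  (∀ x, 0 ≤ p x) ∧ ∑ x, p x = 1

/-- Strong subadditivity with Petz remainder term, on all finite-dimensional systems. -/
def StrongSubadditivity : Prop :=
  ∀ (A B C : Type u) [Fintype A] [DecidableEq A] [Fintype B] [DecidableEq B]
    [Fintype C] [DecidableEq C] (ω : Matrix (A × B × C) (A × B × C) ℂ),
    IsDensity ω → (trLeft (trLeft ω)).PosDef →
      ((buresSq ω (petzCtoAC ω (trLeft ω)) : ℝ) : EReal) ≤ condMutualInfo ω

/-- Concavity of conditional entropy with Petz remainder term. -/
def ConcavityCondEntropy : Prop :=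
  ∀ (X A B : Type u) [Fintype X] [Fintype A] [DecidableEq A] [Fintype B] [DecidableEq B]
    (p : X → ℝ) (ρ : X → Matrix (A × B) (A × B) ℂ),
    IsProb p → (∀ x, IsDensity (ρ x)) → (trLeft (∑ y, p y • ρ y)).PosDef →
      ((∑ x, p x * buresSq (ρ x) (petzPartialTrace (∑ y, p y • ρ y) (trLeft (ρ x))) : ℝ) : EReal)
        ≤ condEntropy (∑ y, p y • ρ y) - ∑ x, (p x : EReal) * condEntropy (ρ x)

/-- Monotonicity of relative entropy under partial trace, with Petz remainder term. -/
def MonotonicityPartialTrace : Prop :=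
  ∀ (A B : Type u) [Fintype A] [DecidableEq A] [Fintype B] [DecidableEq B]
    (ρ σ : Matrix (A × B) (A × B) ℂ),
    IsDensity ρ → IsDensity σ → supp ρ ≤ supp σ → (trLeft σ).PosDef →
      ((buresSq ρ (petzPartialTrace σ (trLeft ρ)) : ℝ) : EReal)
        ≤ relEntropy ρ σ - relEntropy (trLeft ρ) (trLeft σ)

/-- Joint convexity of relative entropy with Petz remainder term. -/
def JointConvexity : Prop :=
  ∀ (X S : Type u) [Fintype X] [Fintype S] [DecidableEq S]
    (p : X → ℝ) (ρ σ : X → Matrix S S ℂ),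
    IsProb p → (∀ x, IsDensity (ρ x)) → (∀ x, IsDensity (σ x)) →
    (∀ x, supp (ρ x) ≤ supp (σ x)) → (∑ y, p y • σ y).PosDef →
      ((∑ x, p x * buresSq (ρ x)
          (msqrt (σ x) * minvsqrt (∑ y, p y • σ y) * (∑ y, p y • ρ y) *
            minvsqrt (∑ y, p y • σ y) * msqrt (σ x)) : ℝ) : EReal)
        ≤ (∑ x, (p x : EReal) * relEntropy (ρ x) (σ x)) -
          relEntropy (∑ y, p y • ρ y) (∑ y, p y • σ y)

/-- Monotonicity of relative entropy under quantum channels, with Petz remainder term. -/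
def MonotonicityChannel : Prop :=
  ∀ (S B : Type u) [Fintype S] [DecidableEq S] [Fintype B] [DecidableEq B]
    (ρ σ : Matrix S S ℂ) (N : Matrix S S ℂ →ₗ[ℂ] Matrix B B ℂ),
    IsDensity ρ → IsDensity σ → supp ρ ≤ supp σ → IsCPTP N → (N σ).PosDef →
      ((buresSq ρ (petz σ N (N ρ)) : ℝ) : EReal)
        ≤ relEntropy ρ σ - relEntropy (N ρ) (N σ)

end

end PetzRemainder

/-!
Monotonicity under partial trace (3) is the hub.

* 3 → 1: take `σ = ω_AC ⊗ I_B`; the inequality extends to unnormalised `σ` because rescaling `σ`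
  shifts both relative entropies equally and leaves the Petz map unchanged.
* 1 → 2 and 3 → 4: apply the hypothesis to the classical-quantum states `⊕ p(x) ρ_x`, for which
  relative entropies, Bures distances and Petz maps are block diagonal.
* 4 → 3: average over the signed permutations of the `A` basis, which turns `M_AB` into
  `I_A / dim A ⊗ M_B`.
* 3 ↔ 5: a channel is a partial trace after an isometry (Stinespring), and conversely.
* 2 → 3: mix a little of `ρ` into `σ`, with weights `1 - t` and `t`. For `σ_t = (1 - t) σ + t ρ`
  the `σ` branch contributes at most `D(σ‖σ_t)`, by Klein's inequality and nonnegativity of the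
  Bures term, and a chi-square bound gives `D(σ‖σ_t) = o(t)`. Divide by `t` and let `t → 0`.
-/

namespace PetzRemainder

noncomputable section

section FunctionalCalculus

variable {𝕜 m n : Type*} [RCLike 𝕜] [Fintype m] [DecidableEq m] [Fintype n] [DecidableEq n]

theorem continuousOn_spectrum (M : Matrix n n 𝕜) (f : ℝ → ℝ) : ContinuousOn f (spectrum ℝ M) :=
  M.finite_real_spectrum.continuousOn f

theorem isHermitian_cfc (f : ℝ → ℝ) (M : Matrix n n 𝕜) : (cfc f M).IsHermitian :=
  cfc_predicate (p := IsSelfAdjoint) f M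

open scoped MatrixOrder in
theorem posSemidef_cfc {f : ℝ → ℝ} {M : Matrix n n 𝕜} (h : ∀ t ∈ spectrum ℝ M, 0 ≤ f t) :
    (cfc f M).PosSemidef :=
  Matrix.nonneg_iff_posSemidef.1 (cfc_nonneg h)

theorem spectrum_nonneg_of_posSemidef {M : Matrix n n 𝕜} (hM : M.PosSemidef) {t : ℝ}
    (ht : t ∈ spectrum ℝ M) : 0 ≤ t := by
  rw [hM.1.spectrum_real_eq_range_eigenvalues] at ht
  obtain ⟨i, rfl⟩ := ht
  exact hM.eigenvalues_nonneg i

theorem spectrum_pos_of_posDef {M : Matrix n n 𝕜} (hM : M.PosDef) {t : ℝ}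
    (ht : t ∈ spectrum ℝ M) : 0 < t := by
  rw [hM.1.spectrum_real_eq_range_eigenvalues] at ht
  obtain ⟨i, rfl⟩ := ht
  exact hM.eigenvalues_pos i

theorem cfc_mul_cfc (f g : ℝ → ℝ) (M : Matrix n n 𝕜) :
    cfc f M * cfc g M = cfc (fun t => f t * g t) M :=
  (cfc_mul f g M (continuousOn_spectrum M f) (continuousOn_spectrum M g)).symm

theorem mul_cfc {M : Matrix n n 𝕜} (hM : M.IsHermitian) (f : ℝ → ℝ) :
    M * cfc f M = cfc (fun t => t * f t) M := by
  simpa only [cfc_id' ℝ M hM.isSelfAdjoint] using cfc_mul_cfc (fun t => t) f M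

theorem cfc_mul_self {M : Matrix n n 𝕜} (hM : M.IsHermitian) (f : ℝ → ℝ) :
    cfc f M * M = cfc (fun t => f t * t) M := by
  simpa only [cfc_id' ℝ M hM.isSelfAdjoint] using cfc_mul_cfc f (fun t => t) M

theorem cfc_smul_arg (c : ℝ) (f : ℝ → ℝ) {M : Matrix n n 𝕜} (hM : M.IsHermitian) :
    cfc f (c • M) = cfc (fun t => f (c * t)) M :=
  (cfc_comp_smul c f M ((M.finite_real_spectrum.image _).continuousOn _) hM.isSelfAdjoint).symm

theorem aeval_mul_eq_mul_aeval {A : Matrix m m 𝕜} {B : Matrix n n 𝕜} {V : Matrix m n 𝕜}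
    (h : A * V = V * B) (q : Polynomial ℝ) :
    Polynomial.aeval A q * V = V * Polynomial.aeval B q := by
  induction q using Polynomial.induction_on with
  | C c => simp only [Polynomial.aeval_C, Algebra.algebraMap_eq_smul_one, Matrix.smul_mul,
      Matrix.mul_smul, Matrix.one_mul, Matrix.mul_one]
  | add p q hp hq => simp only [map_add, Matrix.add_mul, Matrix.mul_add, hp, hq]
  | monomial k c ih =>
    rw [pow_succ, ← mul_assoc, map_mul, map_mul _ _ Polynomial.X, Polynomial.aeval_X,
      Polynomial.aeval_X, Matrix.mul_assoc, h, ← Matrix.mul_assoc, ih, Matrix.mul_assoc]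

-- On a finite spectrum every function is a polynomial.
theorem cfc_mul_eq_mul_cfc {A : Matrix m m 𝕜} {B : Matrix n n 𝕜} (hA : A.IsHermitian)
    (hB : B.IsHermitian) {V : Matrix m n 𝕜} (h : A * V = V * B) (f : ℝ → ℝ) :
    cfc f A * V = V * cfc f B := by
  have hfin := A.finite_real_spectrum.union B.finite_real_spectrum
  set q := Lagrange.interpolate hfin.toFinset id f
  have hq : ∀ t ∈ spectrum ℝ A ∪ spectrum ℝ B, f t = q.eval t := fun t ht =>
    (Lagrange.eval_interpolate_at_node f Function.injective_id.injOn
      (hfin.mem_toFinset.2 ht)).symm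
  rw [cfc_congr fun t ht => hq t (Or.inl ht), cfc_congr fun t ht => hq t (Or.inr ht),
    cfc_polynomial q A hA.isSelfAdjoint, cfc_polynomial q B hB.isSelfAdjoint,
    aeval_mul_eq_mul_aeval h]

theorem cfc_mul_eq_zero {M : Matrix n n 𝕜} (hM : M.IsHermitian) {N : Matrix n n 𝕜}
    (h : M * N = 0) {f : ℝ → ℝ} (hf : f 0 = 0) : cfc f M * N = 0 := by
  rw [cfc_mul_eq_mul_cfc hM Matrix.isHermitian_zero (B := 0) (h.trans (mul_zero N).symm),
    cfc_apply_zero, hf, map_zero, mul_zero]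

theorem cfc_conj_isometry {V : Matrix m n 𝕜} (hV : Vᴴ * V = 1) {M : Matrix n n 𝕜}
    (hM : M.IsHermitian) {f : ℝ → ℝ} (hf : f 0 = 0) :
    cfc f (V * M * Vᴴ) = V * cfc f M * Vᴴ := by
  have hVM := Matrix.isHermitian_mul_mul_conjTranspose V hM
  have hrange : cfc f (V * M * Vᴴ) * V = V * cfc f M :=
    cfc_mul_eq_mul_cfc hVM hM (by rw [Matrix.mul_assoc, hV, Matrix.mul_one]) f
  have hcompl : cfc f (V * M * Vᴴ) * (1 - V * Vᴴ) = 0 := cfc_mul_eq_zero hVM (by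
    rw [Matrix.mul_sub, Matrix.mul_one, ← Matrix.mul_assoc _ V, Matrix.mul_assoc _ Vᴴ V, hV,
      Matrix.mul_one, sub_self]) hf
  rwa [Matrix.mul_sub, Matrix.mul_one, ← Matrix.mul_assoc, hrange, sub_eq_zero] at hcompl

theorem cfc_add_orthogonal_projection {M P : Matrix n n 𝕜} (hM : M.IsHermitian)
    (hP : P.IsHermitian) (hPP : P * P = P) (hMP : M * P = 0) {f : ℝ → ℝ}
    (h0 : f 0 = 0) (h1 : f 1 = 0) : cfc f (M + P) = cfc f M := by
  have hPM : P * M = 0 := by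
    simpa only [Matrix.conjTranspose_mul, hM.eq, hP.eq, Matrix.conjTranspose_zero] using
      congrArg Matrix.conjTranspose hMP
  have hrange : cfc f (M + P) * P = 0 := by
    have hP1 : (M + P) * P = P * 1 := by rw [Matrix.add_mul, hMP, hPP, zero_add, Matrix.mul_one]
    rw [cfc_mul_eq_mul_cfc (hM.add hP) Matrix.isHermitian_one hP1, cfc_apply_one, h1, map_zero,
      Matrix.mul_zero]
  have hcompl : cfc f (M + P) * (1 - P) = (1 - P) * cfc f M :=
    cfc_mul_eq_mul_cfc (hM.add hP) hM (by
      rw [Matrix.add_mul, Matrix.mul_sub, Matrix.mul_sub, Matrix.sub_mul, hMP, hPP, hPM]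
      simp only [Matrix.mul_one, Matrix.one_mul, sub_zero, sub_self, add_zero]) f
  have hker : P * cfc f M = 0 := by
    simpa only [Matrix.conjTranspose_mul, (isHermitian_cfc f M).eq, hP.eq,
      Matrix.conjTranspose_zero] using congrArg Matrix.conjTranspose (cfc_mul_eq_zero hM hMP h0)
  rwa [Matrix.mul_sub, hrange, Matrix.sub_mul, hker, Matrix.mul_one, Matrix.one_mul, sub_zero,
    sub_zero] at hcompl

end FunctionalCalculus

section PseudoInverse

variable {𝕜 n : Type*} [RCLike 𝕜] [Fintype n] [DecidableEq n]

/-- The Moore–Penrose inverse of a Hermitian matrix: it inverts the nonzero eigenvalues and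
vanishes on the kernel, as `(0 : ℝ)⁻¹ = 0`. -/
def pinv (M : Matrix n n 𝕜) : Matrix n n 𝕜 := cfc (fun t : ℝ => t⁻¹) M

/-- The orthogonal projection onto the kernel of a Hermitian matrix. -/
def kerProj (M : Matrix n n 𝕜) : Matrix n n 𝕜 := cfc (fun t : ℝ => if t = 0 then 1 else 0) M

theorem isHermitian_kerProj (M : Matrix n n 𝕜) : (kerProj M).IsHermitian := isHermitian_cfc _ _

theorem posSemidef_kerProj (M : Matrix n n 𝕜) : (kerProj M).PosSemidef :=
  posSemidef_cfc fun t _ => by positivity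

theorem kerProj_mul_self (M : Matrix n n 𝕜) : kerProj M * kerProj M = kerProj M := by
  rw [kerProj, cfc_mul_cfc]
  simp only [mul_ite, mul_one, mul_zero, ← ite_and, and_self]

theorem mul_kerProj {M : Matrix n n 𝕜} (hM : M.IsHermitian) : M * kerProj M = 0 := by
  rw [kerProj, mul_cfc hM, ← cfc_const_zero ℝ M]
  exact cfc_congr fun t _ => by simp

theorem mul_pinv {M : Matrix n n 𝕜} (hM : M.IsHermitian) : M * pinv M = 1 - kerProj M := by
  rw [pinv, mul_cfc hM, kerProj, ← cfc_const_one ℝ M hM.isSelfAdjoint,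
    ← cfc_sub _ _ _ (continuousOn_spectrum M _) (continuousOn_spectrum M _)]
  refine cfc_congr fun t _ => ?_
  by_cases ht : t = 0 <;> simp [ht]

theorem kerProj_of_posDef {M : Matrix n n 𝕜} (hM : M.PosDef) : kerProj M = 0 := by
  rw [kerProj, ← cfc_const_zero ℝ M]
  exact cfc_congr fun t ht => if_neg (spectrum_pos_of_posDef hM ht).ne'

theorem mul_pinv_of_posDef {M : Matrix n n 𝕜} (hM : M.PosDef) : M * pinv M = 1 := by
  rw [mul_pinv hM.1, kerProj_of_posDef hM, sub_zero]

end PseudoInverse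

section SquareRoots

variable {m n : Type*} [Fintype m] [DecidableEq m] [Fintype n] [DecidableEq n]

theorem isHermitian_msqrt (M : Matrix n n ℂ) : (msqrt M).IsHermitian := isHermitian_cfc _ _

theorem isHermitian_minvsqrt (M : Matrix n n ℂ) : (minvsqrt M).IsHermitian := isHermitian_cfc _ _

theorem posSemidef_msqrt (M : Matrix n n ℂ) : (msqrt M).PosSemidef :=
  posSemidef_cfc fun t _ => Real.sqrt_nonneg t

theorem msqrt_mul_self {M : Matrix n n ℂ} (hM : M.PosSemidef) : msqrt M * msqrt M = M := by
  rw [msqrt, cfc_mul_cfc]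
  nth_rw 2 [← cfc_id ℝ M hM.1.isSelfAdjoint]
  exact cfc_congr fun t ht => Real.mul_self_sqrt (spectrum_nonneg_of_posSemidef hM ht)

theorem msqrt_smul {c : ℝ} (hc : 0 ≤ c) {M : Matrix n n ℂ} (hM : M.IsHermitian) :
    msqrt (c • M) = √c • msqrt M := by
  rw [msqrt, cfc_smul_arg c _ hM, msqrt, ← cfc_const_mul _ _ _ (continuousOn_spectrum M _)]
  exact cfc_congr fun t _ => Real.sqrt_mul hc t

theorem minvsqrt_smul {c : ℝ} (hc : 0 ≤ c) {M : Matrix n n ℂ} (hM : M.IsHermitian) :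
    minvsqrt (c • M) = (√c)⁻¹ • minvsqrt M := by
  rw [minvsqrt, cfc_smul_arg c _ hM, minvsqrt, ← cfc_const_mul _ _ _ (continuousOn_spectrum M _)]
  exact cfc_congr fun t _ => by rw [Real.sqrt_mul hc t, mul_inv]

theorem minvsqrt_mul_self {M : Matrix n n ℂ} (hM : M.IsHermitian) :
    minvsqrt M * M = msqrt M := by
  rw [minvsqrt, cfc_mul_self hM, msqrt]
  exact cfc_congr fun t _ => by rw [inv_mul_eq_div, Real.div_sqrt]

theorem msqrt_mul_minvsqrt {M : Matrix n n ℂ} (hM : M.PosSemidef) :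
    msqrt M * minvsqrt M = 1 - kerProj M := by
  rw [msqrt, minvsqrt, cfc_mul_cfc, kerProj, ← cfc_const_one ℝ M hM.1.isSelfAdjoint,
    ← cfc_sub _ _ _ (continuousOn_spectrum M _) (continuousOn_spectrum M _)]
  refine cfc_congr fun t ht => ?_
  rcases (spectrum_nonneg_of_posSemidef hM ht).eq_or_lt with rfl | ht
  · simp
  · simp [ht.ne', (Real.sqrt_pos.2 ht).ne']

theorem minvsqrt_mul_kerProj (M : Matrix n n ℂ) : minvsqrt M * kerProj M = 0 := by
  rw [minvsqrt, kerProj, cfc_mul_cfc, ← cfc_const_zero ℝ M]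
  exact cfc_congr fun t _ => by by_cases ht : t = 0 <;> simp [ht]

theorem minvsqrt_mul_mul_minvsqrt {M : Matrix n n ℂ} (hM : M.PosSemidef) :
    minvsqrt M * M * minvsqrt M = 1 - kerProj M := by
  rw [minvsqrt_mul_self hM.1, msqrt_mul_minvsqrt hM]

theorem mul_mlog_smul {c : ℝ} (hc : c ≠ 0) {M : Matrix n n ℂ} (hM : M.IsHermitian) :
    M * mlog (c • M) = Real.log c • M + M * mlog M := by
  have hid : Real.log c • M = cfc (fun t => Real.log c * id t) M := by
    rw [cfc_const_mul _ _ _ (continuousOn_spectrum M _), cfc_id ℝ M hM.isSelfAdjoint]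
  rw [mlog, cfc_smul_arg c _ hM, mlog, mul_cfc hM, mul_cfc hM, hid,
    ← cfc_add _ _ _ (continuousOn_spectrum M _) (continuousOn_spectrum M _)]
  refine cfc_congr fun t _ => ?_
  rcases eq_or_ne t 0 with rfl | ht
  · simp
  · rw [Real.log_mul hc ht, id, mul_add, mul_comm t (Real.log c)]

theorem msqrt_conj_isometry {V : Matrix m n ℂ} (hV : Vᴴ * V = 1) {M : Matrix n n ℂ}
    (hM : M.IsHermitian) : msqrt (V * M * Vᴴ) = V * msqrt M * Vᴴ :=
  cfc_conj_isometry hV hM Real.sqrt_zero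

theorem mlog_conj_isometry {V : Matrix m n ℂ} (hV : Vᴴ * V = 1) {M : Matrix n n ℂ}
    (hM : M.IsHermitian) : mlog (V * M * Vᴴ) = V * mlog M * Vᴴ :=
  cfc_conj_isometry hV hM Real.log_zero

end SquareRoots

section Support

variable {m n : Type*} [Fintype m] [Fintype n]

theorem supp_le_supp_iff {ρ σ : Matrix n n ℂ} : supp ρ ≤ supp σ ↔ ∃ X, ρ = σ * X := by
  classical
  constructor
  · intro h
    have hcol (j) : ∃ v, σ *ᵥ v = ρ *ᵥ Pi.single j 1 := h ⟨Pi.single j 1, rfl⟩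
    choose v hv using hcol
    refine ⟨Matrix.of fun i j => v j i, ?_⟩
    ext i j
    rw [← Matrix.col_apply ρ, ← Matrix.mulVec_single_one, ← hv]
    rfl
  · rintro ⟨X, rfl⟩ _ ⟨v, rfl⟩
    exact ⟨X *ᵥ v, by simp only [Matrix.mulVecLin_apply, Matrix.mulVec_mulVec]⟩

theorem exists_eq_mul_right_of_supp_le {ρ σ : Matrix n n ℂ} (hρ : ρ.IsHermitian)
    (hσ : σ.IsHermitian) (h : supp ρ ≤ supp σ) : ∃ X, ρ = X * σ := by
  obtain ⟨X, hX⟩ := supp_le_supp_iff.1 h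
  exact ⟨Xᴴ, by rw [← hρ.eq, hX, Matrix.conjTranspose_mul, hσ.eq]⟩

theorem supp_le_supp_smul {ρ σ : Matrix n n ℂ} {c : ℝ} (hc : c ≠ 0) (h : supp ρ ≤ supp σ) :
    supp ρ ≤ supp (c • σ) := by
  obtain ⟨X, rfl⟩ := supp_le_supp_iff.1 h
  exact supp_le_supp_iff.2 ⟨c⁻¹ • X, by
    rw [Matrix.smul_mul, Matrix.mul_smul, smul_inv_smul₀ hc]⟩

theorem supp_smul_le_supp_smul {ρ σ : Matrix n n ℂ} (c : ℝ) (h : supp ρ ≤ supp σ) :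
    supp (c • ρ) ≤ supp (c • σ) := by
  obtain ⟨X, rfl⟩ := supp_le_supp_iff.1 h
  exact supp_le_supp_iff.2 ⟨X, by rw [Matrix.smul_mul]⟩

theorem supp_conj_le_supp_conj [DecidableEq n] {V : Matrix m n ℂ} (hV : Vᴴ * V = 1)
    {ρ σ : Matrix n n ℂ} (h : supp ρ ≤ supp σ) : supp (V * ρ * Vᴴ) ≤ supp (V * σ * Vᴴ) := by
  obtain ⟨X, rfl⟩ := supp_le_supp_iff.1 h
  refine supp_le_supp_iff.2 ⟨V * X * Vᴴ, ?_⟩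
  calc V * (σ * X) * Vᴴ = V * σ * (Vᴴ * V) * X * Vᴴ := by
        rw [hV, Matrix.mul_one, Matrix.mul_assoc V σ X]
    _ = V * σ * Vᴴ * (V * X * Vᴴ) := by simp only [Matrix.mul_assoc]

theorem supp_le_supp_of_posDef (ρ : Matrix n n ℂ) {σ : Matrix n n ℂ} (hσ : σ.PosDef) :
    supp ρ ≤ supp σ := by
  classical
  exact supp_le_supp_iff.2 ⟨pinv σ * ρ, by
    rw [← Matrix.mul_assoc, mul_pinv_of_posDef hσ, Matrix.one_mul]⟩

variable [DecidableEq n]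

theorem supp_le_supp_iff_mul_kerProj_eq_zero {ρ σ : Matrix n n ℂ} (hρ : ρ.IsHermitian)
    (hσ : σ.IsHermitian) : supp ρ ≤ supp σ ↔ ρ * kerProj σ = 0 := by
  constructor
  · intro h
    obtain ⟨X, rfl⟩ := exists_eq_mul_right_of_supp_le hρ hσ h
    rw [Matrix.mul_assoc, mul_kerProj hσ, Matrix.mul_zero]
  · intro h
    have hker : kerProj σ * ρ = 0 := by
      simpa only [Matrix.conjTranspose_mul, hρ.eq, (isHermitian_kerProj σ).eq,
        Matrix.conjTranspose_zero] using congrArg Matrix.conjTranspose h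
    exact supp_le_supp_iff.2 ⟨pinv σ * ρ, by
      rw [← Matrix.mul_assoc, mul_pinv hσ, Matrix.sub_mul, Matrix.one_mul, hker, sub_zero]⟩

theorem supp_le_supp_of_trace_mul_kerProj_eq_zero {ρ σ : Matrix n n ℂ} (hρ : ρ.PosSemidef)
    (hσ : σ.IsHermitian) (h : (ρ * kerProj σ).trace = 0) : supp ρ ≤ supp σ := by
  have hsqrt : msqrt ρ * kerProj σ = 0 := by
    rw [← Matrix.trace_conjTranspose_mul_self_eq_zero_iff, Matrix.conjTranspose_mul,
      (isHermitian_kerProj σ).eq, (isHermitian_msqrt ρ).eq, Matrix.mul_assoc,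
      ← Matrix.mul_assoc (msqrt ρ), msqrt_mul_self hρ, Matrix.trace_mul_comm, Matrix.mul_assoc,
      kerProj_mul_self, h]
  rw [supp_le_supp_iff_mul_kerProj_eq_zero hρ.1 hσ, ← msqrt_mul_self hρ, Matrix.mul_assoc, hsqrt,
    Matrix.mul_zero]

end Support

section BlockOperators

variable {m n X : Type*} [DecidableEq X]

/-- The block diagonal operator with blocks `M x`, on a space whose basis `m` is identified with
`n × X`: the classical–quantum operator `∑ x, M x ⊗ |x⟩⟨x|`. -/
def blockOp (e : m ≃ n × X) (M : X → Matrix n n ℂ) : Matrix m m ℂ :=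
  (Matrix.blockDiagonal M).submatrix e e

/-- The isometry `v ↦ v ⊗ |x⟩` onto the `x`-th block of `blockOp`. -/
def blockEmbedding [DecidableEq n] (e : m ≃ n × X) (x : X) : Matrix m n ℂ :=
  (1 : Matrix (n × X) (n × X) ℂ).submatrix e fun j => (j, x)

theorem blockOp_apply (e : m ≃ n × X) (M : X → Matrix n n ℂ) (i j : m) :
    blockOp e M i j = if (e i).2 = (e j).2 then M (e i).2 (e i).1 (e j).1 else 0 :=
  Matrix.blockDiagonal_apply _ _ _

theorem blockOp_sub (e : m ≃ n × X) (M N : X → Matrix n n ℂ) :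
    blockOp e M - blockOp e N = blockOp e fun x => M x - N x :=
  congrArg (fun K : Matrix (n × X) (n × X) ℂ => K.submatrix e e)
    (Matrix.blockDiagonal_sub M N).symm

theorem conjTranspose_blockOp (e : m ≃ n × X) (M : X → Matrix n n ℂ) :
    (blockOp e M)ᴴ = blockOp e fun x => (M x)ᴴ := by
  rw [blockOp, Matrix.conjTranspose_submatrix, Matrix.blockDiagonal_conjTranspose, blockOp]

theorem isHermitian_blockOp (e : m ≃ n × X) {M : X → Matrix n n ℂ}
    (hM : ∀ x, (M x).IsHermitian) : (blockOp e M).IsHermitian :=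
  (Matrix.isHermitian_blockDiagonal_iff.2 hM).submatrix e

theorem blockOp_mul [Fintype m] [Fintype n] [Finite X] (e : m ≃ n × X)
    (M N : X → Matrix n n ℂ) : blockOp e M * blockOp e N = blockOp e fun x => M x * N x := by
  cases nonempty_fintype X
  rw [blockOp, blockOp, blockOp, Matrix.submatrix_mul_equiv, Matrix.blockDiagonal_mul]

theorem trace_blockOp [Fintype m] [Fintype n] [Fintype X] (e : m ≃ n × X)
    (M : X → Matrix n n ℂ) : (blockOp e M).trace = ∑ x, (M x).trace := by
  rw [← Matrix.trace_blockDiagonal, blockOp, Matrix.trace, Matrix.trace]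
  exact e.sum_comp fun i => (Matrix.blockDiagonal M).diag i

theorem supp_blockOp_le [Fintype m] [Fintype n] [Finite X] (e : m ≃ n × X)
    {M N : X → Matrix n n ℂ} (h : ∀ x, supp (M x) ≤ supp (N x)) :
    supp (blockOp e M) ≤ supp (blockOp e N) := by
  choose Y hY using fun x => supp_le_supp_iff.1 (h x)
  exact supp_le_supp_iff.2 ⟨blockOp e Y, by rw [blockOp_mul]; exact congrArg _ (funext hY)⟩

theorem sum_blockEmbedding_mul_conjTranspose [DecidableEq m] [Fintype n] [DecidableEq n]
    [Fintype X] (e : m ≃ n × X) :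
    ∑ x, blockEmbedding e x * (blockEmbedding e x)ᴴ = 1 := by
  ext i j
  have hone : (1 : Matrix (n × X) (n × X) ℂ) * 1 = 1 := Matrix.mul_one 1
  rw [Matrix.sum_apply, ← Matrix.submatrix_one_equiv e, Matrix.submatrix_apply, ← hone,
    Matrix.mul_apply, Fintype.sum_prod_type_right]
  refine Finset.sum_congr rfl fun x _ => ?_
  simp [blockEmbedding, Matrix.mul_apply, Matrix.one_apply, eq_comm]

theorem blockOp_mul_blockEmbedding [Fintype m] [Fintype n] [DecidableEq n] [Finite X]
    (e : m ≃ n × X) (M : X → Matrix n n ℂ) (x : X) :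
    blockOp e M * blockEmbedding e x = blockEmbedding e x * M x := by
  cases nonempty_fintype X
  ext i j
  obtain ⟨⟨k, y⟩, rfl⟩ := e.symm.surjective i
  rw [blockOp, blockEmbedding, Matrix.submatrix_mul_equiv, Matrix.mul_one, Matrix.submatrix_apply,
    Matrix.blockDiagonal_apply, Matrix.mul_apply]
  rcases eq_or_ne y x with rfl | h
  · simp [Matrix.one_apply]
  · simp [h]

theorem eq_sum_mul_blockEmbedding [Fintype m] [Fintype n] [DecidableEq n] [Fintype X]
    (e : m ≃ n × X) (M : Matrix m m ℂ) :
    M = ∑ x, M * blockEmbedding e x * (blockEmbedding e x)ᴴ := by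
  classical
  simp only [Matrix.mul_assoc]
  rw [← Finset.mul_sum, sum_blockEmbedding_mul_conjTranspose, Matrix.mul_one]

theorem blockOp_eq_sum [Finite m] [Fintype n] [DecidableEq n] [Fintype X] (e : m ≃ n × X)
    (M : X → Matrix n n ℂ) :
    blockOp e M = ∑ x, blockEmbedding e x * M x * (blockEmbedding e x)ᴴ := by
  cases nonempty_fintype m
  simpa only [blockOp_mul_blockEmbedding] using eq_sum_mul_blockEmbedding e (blockOp e M)

theorem posSemidef_blockOp [Finite m] [Finite n] [Finite X] (e : m ≃ n × X)
    {M : X → Matrix n n ℂ} (hM : ∀ x, (M x).PosSemidef) : (blockOp e M).PosSemidef := by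
  classical
  cases nonempty_fintype m
  cases nonempty_fintype n
  cases nonempty_fintype X
  rw [blockOp_eq_sum]
  exact Matrix.posSemidef_sum _ fun x _ => (hM x).mul_mul_conjTranspose_same _

variable [Fintype m] [DecidableEq m] [Fintype n] [DecidableEq n] [Finite X]

theorem cfc_blockOp (e : m ≃ n × X) {M : X → Matrix n n ℂ} (hM : ∀ x, (M x).IsHermitian)
    (f : ℝ → ℝ) : cfc f (blockOp e M) = blockOp e fun x => cfc f (M x) := by
  cases nonempty_fintype X
  rw [eq_sum_mul_blockEmbedding e (cfc f _), blockOp_eq_sum e fun x => cfc f (M x)]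
  refine Finset.sum_congr rfl fun x _ => ?_
  rw [cfc_mul_eq_mul_cfc (isHermitian_blockOp e hM) (hM x) (blockOp_mul_blockEmbedding e M x)]

theorem msqrt_blockOp (e : m ≃ n × X) {M : X → Matrix n n ℂ} (hM : ∀ x, (M x).IsHermitian) :
    msqrt (blockOp e M) = blockOp e fun x => msqrt (M x) := cfc_blockOp e hM _

theorem mlog_blockOp (e : m ≃ n × X) {M : X → Matrix n n ℂ} (hM : ∀ x, (M x).IsHermitian) :
    mlog (blockOp e M) = blockOp e fun x => mlog (M x) := cfc_blockOp e hM _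

end BlockOperators

section BuresDistance

variable {m n X : Type*}

theorem isHermitian_real_smul {M : Matrix n n ℂ} (hM : M.IsHermitian) (c : ℝ) :
    (c • M).IsHermitian := hM.smul (IsSelfAdjoint.all c)

variable [Fintype m] [Fintype n]

theorem isHermitian_mul_mul_self {M N : Matrix n n ℂ} (hN : N.IsHermitian)
    (hM : M.IsHermitian) : (N * M * N).IsHermitian := by
  simpa only [hN.eq] using Matrix.isHermitian_mul_mul_conjTranspose N hM

theorem trace_conj_isometry [DecidableEq n] {V : Matrix m n ℂ} (hV : Vᴴ * V = 1)
    (M : Matrix n n ℂ) : (V * M * Vᴴ).trace = M.trace := by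
  rw [Matrix.trace_mul_comm, ← Matrix.mul_assoc, hV, Matrix.one_mul]

theorem conj_isometry_mul_conj_isometry [DecidableEq n] {V : Matrix m n ℂ} (hV : Vᴴ * V = 1)
    (M N : Matrix n n ℂ) : (V * M * Vᴴ) * (V * N * Vᴴ) = V * (M * N) * Vᴴ := by
  calc (V * M * Vᴴ) * (V * N * Vᴴ) = V * M * (Vᴴ * V) * N * Vᴴ := by
        simp only [Matrix.mul_assoc]
    _ = V * (M * N) * Vᴴ := by rw [hV, Matrix.mul_one, Matrix.mul_assoc V M N]

variable [DecidableEq m] [DecidableEq n]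

theorem traceNorm_nonneg (M : Matrix n n ℂ) : 0 ≤ traceNorm M :=
  (Complex.nonneg_iff.1 (posSemidef_msqrt _).trace_nonneg).1

theorem traceNorm_smul {c : ℝ} (hc : 0 ≤ c) (M : Matrix n n ℂ) :
    traceNorm (c • M) = c * traceNorm M := by
  have hsq : (c • M)ᴴ * (c • M) = (c * c) • (Mᴴ * M) := by
    rw [Matrix.conjTranspose_smul, Matrix.smul_mul, Matrix.mul_smul, smul_smul, star_trivial]
  rw [traceNorm, hsq, msqrt_smul (by positivity) (Matrix.isHermitian_conjTranspose_mul_self M),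
    Real.sqrt_mul_self hc, Matrix.trace_smul, Complex.smul_re, traceNorm, smul_eq_mul]

theorem traceNorm_conj_isometry {V : Matrix m n ℂ} (hV : Vᴴ * V = 1) (M : Matrix n n ℂ) :
    traceNorm (V * M * Vᴴ) = traceNorm M := by
  have hsq : (V * M * Vᴴ)ᴴ * (V * M * Vᴴ) = V * (Mᴴ * M) * Vᴴ := by
    rw [← conj_isometry_mul_conj_isometry hV]
    simp only [Matrix.conjTranspose_mul, Matrix.conjTranspose_conjTranspose, Matrix.mul_assoc]
  rw [traceNorm, hsq, msqrt_conj_isometry hV (Matrix.isHermitian_conjTranspose_mul_self M),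
    trace_conj_isometry hV, traceNorm]

theorem traceNorm_blockOp [Fintype X] [DecidableEq X] (e : m ≃ n × X) (M : X → Matrix n n ℂ) :
    traceNorm (blockOp e M) = ∑ x, traceNorm (M x) := by
  simp only [traceNorm]
  rw [conjTranspose_blockOp, blockOp_mul,
    msqrt_blockOp e fun x => Matrix.isHermitian_conjTranspose_mul_self (M x), trace_blockOp,
    Complex.re_sum]

theorem buresSq_eq (τ ς : Matrix n n ℂ) :
    buresSq τ ς = 2 * (1 - traceNorm (msqrt τ * msqrt ς)) := by
  rw [buresSq, fidelity, Real.sqrt_sq (traceNorm_nonneg _)]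

theorem buresSq_conj_isometry {V : Matrix m n ℂ} (hV : Vᴴ * V = 1) {τ ς : Matrix n n ℂ}
    (hτ : τ.IsHermitian) (hς : ς.IsHermitian) :
    buresSq (V * τ * Vᴴ) (V * ς * Vᴴ) = buresSq τ ς := by
  rw [buresSq_eq, buresSq_eq, msqrt_conj_isometry hV hτ, msqrt_conj_isometry hV hς,
    conj_isometry_mul_conj_isometry hV, traceNorm_conj_isometry hV]

theorem traceNorm_msqrt_smul_mul_msqrt_smul {c : ℝ} (hc : 0 ≤ c) {τ ς : Matrix n n ℂ}
    (hτ : τ.IsHermitian) (hς : ς.IsHermitian) :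
    traceNorm (msqrt (c • τ) * msqrt (c • ς)) = c * traceNorm (msqrt τ * msqrt ς) := by
  rw [msqrt_smul hc hτ, msqrt_smul hc hς, Matrix.smul_mul, Matrix.mul_smul, smul_smul,
    Real.mul_self_sqrt hc, traceNorm_smul hc]

theorem buresSq_blockOp [Fintype X] [DecidableEq X] (e : m ≃ n × X) {p : X → ℝ} (hp : IsProb p)
    {τ ς : X → Matrix n n ℂ} (hτ : ∀ x, (τ x).IsHermitian) (hς : ∀ x, (ς x).IsHermitian) :
    buresSq (blockOp e fun x => p x • τ x) (blockOp e fun x => p x • ς x) =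
      ∑ x, p x * buresSq (τ x) (ς x) := by
  rw [buresSq_eq, msqrt_blockOp e fun x => isHermitian_real_smul (hτ x) (p x),
    msqrt_blockOp e fun x => isHermitian_real_smul (hς x) (p x), blockOp_mul, traceNorm_blockOp,
    ← hp.2, ← Finset.sum_sub_distrib, Finset.mul_sum]
  refine Finset.sum_congr rfl fun x _ => ?_
  rw [traceNorm_msqrt_smul_mul_msqrt_smul (hp.1 x) (hτ x) (hς x), buresSq_eq]
  ring

end BuresDistance

section RelativeEntropy

variable {m n X : Type*} [Fintype m] [DecidableEq m] [Fintype n] [DecidableEq n]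

/-- The real number `Tr {ρ (log ρ - log σ)}`, which is the relative entropy of `ρ` to `σ` when
`supp ρ ⊆ supp σ`. -/
def umegaki (ρ σ : Matrix n n ℂ) : ℝ := (ρ * (mlog ρ - mlog σ)).trace.re

theorem relEntropy_eq {ρ σ : Matrix n n ℂ} (h : supp ρ ≤ supp σ) :
    relEntropy ρ σ = (umegaki ρ σ : EReal) := if_pos h

theorem relEntropy_sub_relEntropy {ρ σ : Matrix m m ℂ} {ρ' σ' : Matrix n n ℂ}
    (h : supp ρ ≤ supp σ) (h' : supp ρ' ≤ supp σ') :
    relEntropy ρ σ - relEntropy ρ' σ' = ((umegaki ρ σ - umegaki ρ' σ' : ℝ) : EReal) := by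
  rw [relEntropy_eq h, relEntropy_eq h', EReal.coe_sub]

theorem umegaki_eq_sub (ρ σ : Matrix n n ℂ) :
    umegaki ρ σ = (ρ * mlog ρ).trace.re - (ρ * mlog σ).trace.re := by
  rw [umegaki, Matrix.mul_sub, Matrix.trace_sub, Complex.sub_re]

theorem umegaki_conj_isometry {V : Matrix m n ℂ} (hV : Vᴴ * V = 1) {ρ σ : Matrix n n ℂ}
    (hρ : ρ.IsHermitian) (hσ : σ.IsHermitian) :
    umegaki (V * ρ * Vᴴ) (V * σ * Vᴴ) = umegaki ρ σ := by
  rw [umegaki, mlog_conj_isometry hV hρ, mlog_conj_isometry hV hσ, ← Matrix.sub_mul,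
    ← Matrix.mul_sub, conj_isometry_mul_conj_isometry hV, trace_conj_isometry hV, umegaki]

theorem umegaki_blockOp [Fintype X] [DecidableEq X] (e : m ≃ n × X) {ρ σ : X → Matrix n n ℂ}
    (hρ : ∀ x, (ρ x).IsHermitian) (hσ : ∀ x, (σ x).IsHermitian) :
    umegaki (blockOp e ρ) (blockOp e σ) = ∑ x, umegaki (ρ x) (σ x) := by
  simp only [umegaki]
  rw [mlog_blockOp e hρ, mlog_blockOp e hσ, blockOp_sub, blockOp_mul, trace_blockOp,
    Complex.re_sum]

theorem trace_re_mul_mlog_smul {c : ℝ} (hc : c ≠ 0) {ρ σ : Matrix n n ℂ}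
    (hρ : ρ.IsHermitian) (hσ : σ.IsHermitian) (h : supp ρ ≤ supp σ) :
    (ρ * mlog (c • σ)).trace.re = Real.log c * ρ.trace.re + (ρ * mlog σ).trace.re := by
  obtain ⟨X, rfl⟩ := exists_eq_mul_right_of_supp_le hρ hσ h
  rw [Matrix.mul_assoc, mul_mlog_smul hc hσ, Matrix.mul_add, Matrix.mul_smul, Matrix.mul_assoc,
    Matrix.trace_add, Matrix.trace_smul, Complex.add_re, Complex.smul_re, smul_eq_mul]

theorem umegaki_smul_right {c : ℝ} (hc : c ≠ 0) {ρ σ : Matrix n n ℂ}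
    (hρ : ρ.IsHermitian) (hσ : σ.IsHermitian) (h : supp ρ ≤ supp σ) :
    umegaki ρ (c • σ) = umegaki ρ σ - Real.log c * ρ.trace.re := by
  rw [umegaki_eq_sub, trace_re_mul_mlog_smul hc hρ hσ h, umegaki_eq_sub]
  ring

theorem umegaki_smul_left (c : ℝ) {ρ : Matrix n n ℂ} (hρ : ρ.IsHermitian) (σ : Matrix n n ℂ) :
    umegaki (c • ρ) σ = c * umegaki ρ σ + c * Real.log c * ρ.trace.re := by
  rcases eq_or_ne c 0 with rfl | hc
  · simp [umegaki]
  simp only [umegaki_eq_sub, Matrix.smul_mul, Matrix.trace_smul, Complex.smul_re, smul_eq_mul]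
  rw [trace_re_mul_mlog_smul hc hρ hρ le_rfl]
  ring

theorem umegaki_smul_smul (c : ℝ) {ρ σ : Matrix n n ℂ} (hρ : ρ.IsHermitian)
    (hσ : σ.IsHermitian) (h : supp ρ ≤ supp σ) :
    umegaki (c • ρ) (c • σ) = c * umegaki ρ σ := by
  rcases eq_or_ne c 0 with rfl | hc
  · simp [umegaki]
  rw [umegaki_smul_left c hρ, umegaki_smul_right hc hρ hσ h]
  ring

end RelativeEntropy

section PartialTrace

variable {A B C X : Type u}

/-- The partial trace over the left factor as a linear map. -/
def trLeftLinearMap (A B : Type u) [Fintype A] :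
    Matrix (A × B) (A × B) ℂ →ₗ[ℂ] Matrix B B ℂ where
  toFun := trLeft
  map_add' M N := by ext; simp [trLeft, Finset.sum_add_distrib]
  map_smul' c M := by ext; simp [trLeft, Finset.mul_sum]

theorem trLeft_smul [Fintype A] (c : ℝ) (M : Matrix (A × B) (A × B) ℂ) :
    trLeft (c • M) = c • trLeft M := (trLeftLinearMap A B).map_smul_of_tower c M

theorem trLeft_sum [Fintype A] {ι : Type*} (s : Finset ι) (M : ι → Matrix (A × B) (A × B) ℂ) :
    trLeft (∑ i ∈ s, M i) = ∑ i ∈ s, trLeft (M i) := map_sum (trLeftLinearMap A B) M s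

theorem trLeft_sum_smul [Fintype A] [Fintype X] (p : X → ℝ)
    (M : X → Matrix (A × B) (A × B) ℂ) :
    trLeft (∑ x, p x • M x) = ∑ x, p x • trLeft (M x) := by
  simp only [trLeft_sum, trLeft_smul]

theorem trLeft_eq_sum [Fintype A] (M : Matrix (A × B) (A × B) ℂ) :
    trLeft M = ∑ a, M.submatrix (Prod.mk a) (Prod.mk a) := by
  ext; simp [trLeft, Matrix.sum_apply]

theorem isHermitian_trLeft [Fintype A] {M : Matrix (A × B) (A × B) ℂ} (hM : M.IsHermitian) :
    (trLeft M).IsHermitian := by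
  rw [trLeft_eq_sum]
  simp only [Matrix.IsHermitian, Matrix.conjTranspose_sum, (hM.submatrix _).eq]

theorem posSemidef_trLeft [Fintype A] {M : Matrix (A × B) (A × B) ℂ} (hM : M.PosSemidef) :
    (trLeft M).PosSemidef := by
  rw [trLeft_eq_sum]
  exact Matrix.posSemidef_sum _ fun a _ => hM.submatrix _

theorem trace_trLeft [Fintype A] [Fintype B] (M : Matrix (A × B) (A × B) ℂ) :
    (trLeft M).trace = M.trace := by
  simp only [Matrix.trace, Matrix.diag_apply, trLeft, Matrix.of_apply]
  rw [Fintype.sum_prod_type, Finset.sum_comm]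

theorem isDensity_trLeft [Fintype A] [Fintype B] {M : Matrix (A × B) (A × B) ℂ}
    (hM : IsDensity M) : IsDensity (trLeft M) :=
  ⟨posSemidef_trLeft hM.1, (trace_trLeft M).trans hM.2⟩

theorem trLeft_mul_one_kronecker [Fintype A] [DecidableEq A] [Fintype B]
    (M : Matrix (A × B) (A × B) ℂ) (Y : Matrix B B ℂ) :
    trLeft (M * ((1 : Matrix A A ℂ) ⊗ₖ Y)) = trLeft M * Y := by
  rw [trLeft_eq_sum, trLeft_eq_sum, Finset.sum_mul]
  refine Finset.sum_congr rfl fun a _ => ?_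
  ext b b'
  simp [Matrix.mul_apply, Fintype.sum_prod_type, Matrix.one_apply]

theorem trLeft_blockOp [DecidableEq X] [Fintype X] (M : X → Matrix B B ℂ) :
    trLeft (blockOp (Equiv.prodComm X B) M) = ∑ x, M x := by
  ext b b'
  simp [trLeft, blockOp_apply, Matrix.sum_apply]

theorem one_kronecker_eq_blockOp [DecidableEq A] (M : Matrix B B ℂ) :
    (1 : Matrix A A ℂ) ⊗ₖ M = blockOp (Equiv.prodComm A B) fun _ => M := by
  ext x y
  by_cases h : x.1 = y.1 <;> simp [blockOp_apply, Matrix.kroneckerMap_apply, Matrix.one_apply, h]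

theorem isHermitian_one_kronecker [DecidableEq A] {M : Matrix B B ℂ} (hM : M.IsHermitian) :
    ((1 : Matrix A A ℂ) ⊗ₖ M).IsHermitian := by
  rw [one_kronecker_eq_blockOp]
  exact isHermitian_blockOp _ fun _ => hM

theorem cfc_one_kronecker [Fintype A] [DecidableEq A] [Fintype B] [DecidableEq B]
    {M : Matrix B B ℂ} (hM : M.IsHermitian) (f : ℝ → ℝ) :
    cfc f ((1 : Matrix A A ℂ) ⊗ₖ M) = 1 ⊗ₖ cfc f M := by
  rw [one_kronecker_eq_blockOp, cfc_blockOp _ fun _ => hM, one_kronecker_eq_blockOp]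

theorem supp_le_supp_one_kronecker_trLeft [Fintype A] [DecidableEq A] [Fintype B]
    {ω : Matrix (A × B) (A × B) ℂ} (hω : ω.PosSemidef) :
    supp ω ≤ supp ((1 : Matrix A A ℂ) ⊗ₖ trLeft ω) := by
  classical
  have hB := isHermitian_trLeft hω.1
  refine supp_le_supp_of_trace_mul_kerProj_eq_zero hω (isHermitian_one_kronecker hB) ?_
  rw [kerProj, cfc_one_kronecker hB, ← trace_trLeft, trLeft_mul_one_kronecker]
  exact (congrArg Matrix.trace (mul_kerProj hB)).trans (Matrix.trace_zero _ _)

variable [Fintype A] [DecidableEq A] [Fintype B] [DecidableEq B]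

theorem umegaki_one_kronecker (ρ : Matrix (A × B) (A × B) ℂ) {τ : Matrix B B ℂ}
    (hτ : τ.IsHermitian) : umegaki ρ ((1 : Matrix A A ℂ) ⊗ₖ τ) =
      (ρ * mlog ρ).trace.re - (trLeft ρ * mlog τ).trace.re := by
  rw [umegaki_eq_sub, ← trLeft_mul_one_kronecker, trace_trLeft, mlog, mlog, mlog,
    cfc_one_kronecker hτ]

theorem condEntropy_eq {τ : Matrix (A × B) (A × B) ℂ} (hτ : τ.PosSemidef) :
    condEntropy τ =
      (((trLeft τ * mlog (trLeft τ)).trace.re - (τ * mlog τ).trace.re : ℝ) : EReal) := by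
  rw [condEntropy, relEntropy_eq (supp_le_supp_one_kronecker_trLeft hτ),
    umegaki_one_kronecker _ (isHermitian_trLeft hτ.1), ← EReal.coe_neg, neg_sub]

theorem isHermitian_petzPartialTrace (σ : Matrix (A × B) (A × B) ℂ) {Y : Matrix B B ℂ}
    (hY : Y.IsHermitian) : (petzPartialTrace σ Y).IsHermitian :=
  isHermitian_mul_mul_self (isHermitian_msqrt σ) (isHermitian_one_kronecker
    (isHermitian_mul_mul_self (isHermitian_minvsqrt _) hY))

theorem petzPartialTrace_smul_right (σ : Matrix (A × B) (A × B) ℂ) (c : ℝ) (Y : Matrix B B ℂ) :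
    petzPartialTrace σ (c • Y) = c • petzPartialTrace σ Y := by
  simp only [petzPartialTrace, Matrix.mul_smul, Matrix.smul_mul, Matrix.kronecker_smul]

theorem petzPartialTrace_smul_left {c : ℝ} (hc : 0 < c) {σ : Matrix (A × B) (A × B) ℂ}
    (hσ : σ.IsHermitian) (Y : Matrix B B ℂ) :
    petzPartialTrace (c • σ) Y = petzPartialTrace σ Y := by
  simp only [petzPartialTrace, trLeft_smul, msqrt_smul hc.le hσ,
    minvsqrt_smul hc.le (isHermitian_trLeft hσ), Matrix.mul_smul, Matrix.smul_mul,
    Matrix.kronecker_smul, smul_smul]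
  rw [show √c * ((√c)⁻¹ * (√c)⁻¹ * √c) = 1 by field_simp, one_smul]

end PartialTrace

section TensorIdMiddle

variable {A B C : Type u}

/-- The rearrangement `A ⊗ B ⊗ C ≅ (A ⊗ C) ⊗ B`. -/
def midEquiv (A B C : Type u) : A × B × C ≃ (A × C) × B where
  toFun x := ((x.1, x.2.2), x.2.1)
  invFun x := (x.1.1, x.2, x.1.2)

theorem tensorIdMiddle_eq_blockOp [DecidableEq B] (M : Matrix (A × C) (A × C) ℂ) :
    tensorIdMiddle B M = blockOp (midEquiv A B C) fun _ => M := by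
  ext x y
  by_cases h : x.2.1 = y.2.1 <;> simp [tensorIdMiddle, blockOp_apply, midEquiv,
    Matrix.one_apply, h]

theorem trMiddle_blockOp [Fintype B] [DecidableEq B] (M : B → Matrix (A × C) (A × C) ℂ) :
    trMiddle (blockOp (midEquiv A B C) M) = ∑ b, M b := by
  ext x y
  simp [trMiddle, blockOp_apply, midEquiv, Matrix.sum_apply]

theorem trLeft_blockOp_midEquiv [Fintype A] [DecidableEq B] (M : B → Matrix (A × C) (A × C) ℂ) :
    trLeft (blockOp (midEquiv A B C) M) =
      blockOp (Equiv.prodComm B C) fun b => trLeft (M b) := by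
  ext x y
  by_cases h : x.1 = y.1 <;> simp [trLeft, blockOp_apply, midEquiv, h]

theorem one_kronecker_blockOp [DecidableEq A] [DecidableEq B] (M : B → Matrix C C ℂ) :
    (1 : Matrix A A ℂ) ⊗ₖ blockOp (Equiv.prodComm B C) M =
      blockOp (midEquiv A B C) fun b => (1 : Matrix A A ℂ) ⊗ₖ M b := by
  ext x y
  by_cases h : x.2.1 = y.2.1 <;> simp [blockOp_apply, midEquiv, h, Matrix.kroneckerMap_apply]

theorem trLeft_tensorIdMiddle [Fintype A] [DecidableEq B] (M : Matrix (A × C) (A × C) ℂ) :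
    trLeft (tensorIdMiddle B M) = (1 : Matrix B B ℂ) ⊗ₖ trLeft M := by
  rw [tensorIdMiddle_eq_blockOp, trLeft_blockOp_midEquiv, one_kronecker_eq_blockOp]

theorem trLeft_trMiddle [Fintype A] [Fintype B] (ω : Matrix (A × B × C) (A × B × C) ℂ) :
    trLeft (trMiddle ω) = trLeft (trLeft ω) := by
  ext c c'
  simp only [trLeft, trMiddle, Matrix.of_apply]
  exact Finset.sum_comm

theorem trMiddle_eq_trLeft [Fintype B] (ω : Matrix (A × B × C) (A × B × C) ℂ) :
    trMiddle ω = trLeft (ω.submatrix ((Equiv.prodComm _ _).trans (midEquiv A B C).symm)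
      ((Equiv.prodComm B (A × C)).trans (midEquiv A B C).symm)) := rfl

theorem posSemidef_trMiddle [Fintype B] {ω : Matrix (A × B × C) (A × B × C) ℂ}
    (hω : ω.PosSemidef) : (trMiddle ω).PosSemidef := by
  rw [trMiddle_eq_trLeft]
  exact posSemidef_trLeft (hω.submatrix _)

theorem supp_le_supp_tensorIdMiddle_trMiddle [Fintype A] [Fintype B] [DecidableEq B] [Fintype C]
    {ω : Matrix (A × B × C) (A × B × C) ℂ} (hω : ω.PosSemidef) :
    supp ω ≤ supp (tensorIdMiddle B (trMiddle ω)) := by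
  set e := (Equiv.prodComm B (A × C)).trans (midEquiv A B C).symm
  obtain ⟨Y, hY⟩ := supp_le_supp_iff.1 (supp_le_supp_one_kronecker_trLeft (hω.submatrix e))
  have hreindex : tensorIdMiddle B (trMiddle ω) = ((1 : Matrix B B ℂ) ⊗ₖ
      trLeft (ω.submatrix e e)).submatrix e.symm e.symm := by
    ext x y
    exact mul_comm _ _
  refine supp_le_supp_iff.2 ⟨Y.submatrix e.symm e.symm, ?_⟩
  rw [hreindex, Matrix.submatrix_mul_equiv, ← hY]
  simp

end TensorIdMiddle

section Averages

variable {m n X A B : Type u} [Fintype m] [Fintype n] [Fintype X]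

theorem ereal_coe_sum {ι : Type*} (s : Finset ι) (f : ι → ℝ) :
    ((∑ i ∈ s, f i : ℝ) : EReal) = ∑ i ∈ s, (f i : EReal) :=
  map_sum (⟨⟨Real.toEReal, EReal.coe_zero⟩, EReal.coe_add⟩ : ℝ →+ EReal) f s

theorem IsDensity.average {p : X → ℝ} (hp : IsProb p) {ρ : X → Matrix n n ℂ}
    (hρ : ∀ x, IsDensity (ρ x)) : IsDensity (∑ x, p x • ρ x) := by
  refine ⟨Matrix.posSemidef_sum _ fun x _ => (hρ x).1.smul (hp.1 x), ?_⟩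
  simp only [Matrix.trace_sum, Matrix.trace_smul, (hρ _).2, Complex.real_smul, mul_one]
  exact_mod_cast hp.2

theorem IsDensity.nonempty {ρ : Matrix n n ℂ} (h : IsDensity ρ) : Nonempty n := by
  by_contra hn
  rw [not_nonempty_iff] at hn
  simpa [Matrix.trace] using h.2

theorem IsDensity.conj_isometry [DecidableEq n] {V : Matrix m n ℂ} (hV : Vᴴ * V = 1)
    {ρ : Matrix n n ℂ} (hρ : IsDensity ρ) : IsDensity (V * ρ * Vᴴ) :=
  ⟨hρ.1.mul_mul_conjTranspose_same V, (trace_conj_isometry hV ρ).trans hρ.2⟩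

theorem isDensity_blockOp [DecidableEq X] (e : m ≃ n × X) {p : X → ℝ} (hp : IsProb p)
    {ρ : X → Matrix n n ℂ} (hρ : ∀ x, IsDensity (ρ x)) :
    IsDensity (blockOp e fun x => p x • ρ x) := by
  refine ⟨posSemidef_blockOp e fun x => (hρ x).1.smul (hp.1 x), ?_⟩
  rw [trace_blockOp, ← Matrix.trace_sum, (IsDensity.average hp hρ).2]

theorem sum_mul_trace_re (p : X → ℝ) (ρ : X → Matrix n n ℂ) (Y : Matrix n n ℂ) :
    ∑ x, p x * (ρ x * Y).trace.re = ((∑ x, p x • ρ x) * Y).trace.re := by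
  simp only [Matrix.sum_mul, Matrix.trace_sum, Complex.re_sum, Matrix.smul_mul,
    Matrix.trace_smul, Complex.smul_re, smul_eq_mul]

theorem sum_mul_umegaki [DecidableEq n] (p : X → ℝ) (ρ : X → Matrix n n ℂ) :
    ∑ x, p x * umegaki (ρ x) (∑ y, p y • ρ y) = ∑ x, p x * (ρ x * mlog (ρ x)).trace.re -
      ((∑ y, p y • ρ y) * mlog (∑ y, p y • ρ y)).trace.re := by
  rw [← sum_mul_trace_re p ρ, ← Finset.sum_sub_distrib]
  simp only [umegaki_eq_sub, mul_sub]

theorem condEntropy_sub_sum_condEntropy [Fintype A] [DecidableEq A] [Fintype B] [DecidableEq B]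
    {p : X → ℝ} (hp : IsProb p) {ρ : X → Matrix (A × B) (A × B) ℂ}
    (hρ : ∀ x, IsDensity (ρ x)) :
    condEntropy (∑ y, p y • ρ y) - ∑ x, (p x : EReal) * condEntropy (ρ x) =
      ((∑ x, p x * umegaki (ρ x) (∑ y, p y • ρ y) -
        ∑ x, p x * umegaki (trLeft (ρ x)) (trLeft (∑ y, p y • ρ y)) : ℝ) : EReal) := by
  simp only [condEntropy_eq (IsDensity.average hp hρ).1, condEntropy_eq (hρ _).1,
    ← EReal.coe_mul, ← ereal_coe_sum, ← EReal.coe_sub, sum_mul_umegaki, trLeft_sum_smul,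
    sum_mul_umegaki p fun x => trLeft (ρ x), mul_sub, Finset.sum_sub_distrib]
  congr 1
  ring

end Averages

section Twirl

variable {A B : Type u} [Fintype A]

theorem kronecker_one_conj_apply [Fintype B] [DecidableEq B] (K : Matrix A A ℂ)
    (M : Matrix (A × B) (A × B) ℂ) (x y : A × B) :
    ((K ⊗ₖ (1 : Matrix B B ℂ)) * M * (K ⊗ₖ (1 : Matrix B B ℂ))ᴴ) x y =
      (K * M.submatrix (·, x.2) (·, y.2) * Kᴴ) x.1 y.1 := by
  simp [Matrix.mul_apply, Fintype.sum_prod_type, Matrix.one_apply, Matrix.conjTranspose_kronecker]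

variable [DecidableEq A]

/-- The signed permutation matrix with rows permuted by `s.1` and signs `s.2`. Averaging over all
of them depolarizes, and they exist in every dimension without a choice of cyclic order. -/
def signedPerm (s : Equiv.Perm A × (A → ℤˣ)) : Matrix A A ℂ :=
  Matrix.diagonal (fun a => ((s.2 a : ℤ) : ℂ)) * s.1.permMatrix ℂ

theorem signedPerm_mul_conjTranspose (s : Equiv.Perm A × (A → ℤˣ)) :
    signedPerm s * (signedPerm s)ᴴ = 1 := by
  have hsign (a : A) : ((s.2 a : ℤ) : ℂ) * star ((s.2 a : ℤ) : ℂ) = 1 := by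
    rcases Int.units_eq_one_or (s.2 a) with h | h <;> simp [h]
  have hperm : s.1.permMatrix ℂ * (s.1.permMatrix ℂ)ᴴ = 1 := by
    rw [Matrix.conjTranspose_permMatrix, ← Matrix.permMatrix_mul, inv_mul_cancel,
      Matrix.permMatrix_one]
  rw [signedPerm, Matrix.conjTranspose_mul, Matrix.mul_assoc, ← Matrix.mul_assoc _ _ (_)ᴴ, hperm,
    Matrix.one_mul, Matrix.diagonal_conjTranspose, Matrix.diagonal_mul_diagonal]
  simp only [Pi.star_apply, hsign, Matrix.diagonal_one]

theorem signedPerm_conj_apply (s : Equiv.Perm A × (A → ℤˣ)) (N : Matrix A A ℂ) (a a' : A) :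
    (signedPerm s * N * (signedPerm s)ᴴ) a a' =
      ((s.2 a : ℤ) : ℂ) * ((s.2 a' : ℤ) : ℂ) * N (s.1 a) (s.1 a') := by
  have hrow (M : Matrix A A ℂ) (c c' : A) :
      (signedPerm s * M) c c' = ((s.2 c : ℤ) : ℂ) * M (s.1 c) c' := by
    rw [signedPerm, Matrix.mul_assoc, Matrix.diagonal_mul]
    simp [Equiv.Perm.permMatrix, PEquiv.toMatrix_toPEquiv_mul]
  rw [← Matrix.conjTranspose_conjTranspose N, Matrix.mul_assoc, ← Matrix.conjTranspose_mul, hrow,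
    Matrix.conjTranspose_apply, hrow]
  simp [mul_assoc]

theorem sum_sign_mul_sign (a a' : A) :
    ∑ ε : A → ℤˣ, ((ε a : ℤ) : ℂ) * ((ε a' : ℤ) : ℂ) =
      if a = a' then (Fintype.card (A → ℤˣ) : ℂ) else 0 := by
  let χ : (A → ℤˣ) →* ℂ := (Int.castRingHom ℂ).toMonoidHom.comp
    ((Units.coeHom ℤ).comp (Pi.evalMonoidHom (fun _ => ℤˣ) a * Pi.evalMonoidHom (fun _ => ℤˣ) a'))
  have hχ (ε : A → ℤˣ) : ((ε a : ℤ) : ℂ) * ((ε a' : ℤ) : ℂ) = χ ε := by simp [χ]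
  simp only [hχ]
  rcases eq_or_ne a a' with rfl | h
  · simp [χ, ← pow_two]
  rw [if_neg h]
  refine sum_hom_units_eq_zero χ fun htrivial => ?_
  have hflip := DFunLike.congr_fun htrivial (Pi.mulSingle a (-1))
  rw [← hχ] at hflip
  norm_num [h.symm] at hflip

theorem card_mul_sum_perm (f : A → ℂ) (a : A) :
    (Fintype.card A : ℂ) * ∑ π : Equiv.Perm A, f (π a) =
      Fintype.card (Equiv.Perm A) * ∑ c, f c := by
  have hindep (a' : A) : ∑ π : Equiv.Perm A, f (π a') = ∑ π : Equiv.Perm A, f (π a) := by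
    simpa using (Equiv.sum_comp (Equiv.mulRight (Equiv.swap a a')) fun π => f (π a')).symm
  calc (Fintype.card A : ℂ) * ∑ π : Equiv.Perm A, f (π a)
      = ∑ a', ∑ π : Equiv.Perm A, f (π a') := by
        simp only [hindep, Finset.sum_const, Finset.card_univ, nsmul_eq_mul]
    _ = ∑ π : Equiv.Perm A, ∑ c, f c := by
        rw [Finset.sum_comm]
        exact Finset.sum_congr rfl fun π _ => Equiv.sum_comp π f
    _ = Fintype.card (Equiv.Perm A) * ∑ c, f c := by
        rw [Finset.sum_const, Finset.card_univ, nsmul_eq_mul]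

theorem card_smul_sum_signedPerm_conj (N : Matrix A A ℂ) :
    (Fintype.card A : ℂ) • ∑ s, signedPerm s * N * (signedPerm s)ᴴ =
      (Fintype.card (Equiv.Perm A × (A → ℤˣ)) * N.trace) • (1 : Matrix A A ℂ) := by
  ext a a'
  simp only [Matrix.smul_apply, Matrix.sum_apply, signedPerm_conj_apply]
  rw [Fintype.sum_prod_type]
  simp only [← Finset.sum_mul, sum_sign_mul_sign]
  rcases eq_or_ne a a' with rfl | h
  · simp only [if_true, ← Finset.mul_sum, smul_eq_mul, Matrix.one_apply_eq, mul_one]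
    rw [mul_left_comm, card_mul_sum_perm (fun c => N c c) a, Fintype.card_prod, Matrix.trace]
    push_cast
    simp only [Matrix.diag_apply]
    ring
  · simp [h]

variable [Fintype B] [DecidableEq B]

/-- The signed permutation `s` acting on the left tensor factor. -/
def twirlOp (B : Type u) [DecidableEq B] (s : Equiv.Perm A × (A → ℤˣ)) :
    Matrix (A × B) (A × B) ℂ := signedPerm s ⊗ₖ 1

theorem twirlOp_isometry (s : Equiv.Perm A × (A → ℤˣ)) : (twirlOp B s)ᴴ * twirlOp B s = 1 := by
  rw [mul_eq_one_comm, twirlOp, Matrix.conjTranspose_kronecker, ← Matrix.mul_kronecker_mul,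
    signedPerm_mul_conjTranspose, Matrix.conjTranspose_one, Matrix.one_mul,
    Matrix.one_kronecker_one]

theorem twirlOp_mul_one_kronecker (s : Equiv.Perm A × (A → ℤˣ)) (Y : Matrix B B ℂ) :
    twirlOp B s * ((1 : Matrix A A ℂ) ⊗ₖ Y) = (1 ⊗ₖ Y) * twirlOp B s := by
  rw [twirlOp, ← Matrix.mul_kronecker_mul, ← Matrix.mul_kronecker_mul]
  simp only [Matrix.mul_one, Matrix.one_mul]

theorem card_smul_sum_twirl (M : Matrix (A × B) (A × B) ℂ) :
    (Fintype.card A : ℂ) • ∑ s, twirlOp B s * M * (twirlOp B s)ᴴ =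
      (Fintype.card (Equiv.Perm A × (A → ℤˣ)) : ℂ) • ((1 : Matrix A A ℂ) ⊗ₖ trLeft M) := by
  ext ⟨a, b⟩ ⟨a', b'⟩
  have hblock := congrFun₂ (card_smul_sum_signedPerm_conj (M.submatrix (·, b) (·, b'))) a a'
  simp only [Matrix.smul_apply, Matrix.sum_apply] at hblock ⊢
  simp only [twirlOp, kronecker_one_conj_apply]
  rw [hblock]
  simp only [Matrix.trace, Matrix.diag_apply, Matrix.submatrix_apply, Matrix.kroneckerMap_apply,
    trLeft, Matrix.of_apply, smul_eq_mul]
  ring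

theorem average_twirl [Nonempty A] (M : Matrix (A × B) (A × B) ℂ) :
    ∑ s : Equiv.Perm A × (A → ℤˣ), (Fintype.card (Equiv.Perm A × (A → ℤˣ)) : ℝ)⁻¹ •
        (twirlOp B s * M * (twirlOp B s)ᴴ) =
      (Fintype.card A : ℝ)⁻¹ • ((1 : Matrix A A ℂ) ⊗ₖ trLeft M) := by
  have hA : (Fintype.card A : ℝ) ≠ 0 := Nat.cast_ne_zero.2 Fintype.card_ne_zero
  have hX : (Fintype.card (Equiv.Perm A × (A → ℤˣ)) : ℝ) ≠ 0 :=
    Nat.cast_ne_zero.2 Fintype.card_ne_zero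
  have hsum : (Fintype.card A : ℝ) • ∑ s, twirlOp B s * M * (twirlOp B s)ᴴ =
      (Fintype.card (Equiv.Perm A × (A → ℤˣ)) : ℝ) • ((1 : Matrix A A ℂ) ⊗ₖ trLeft M) := by
    simpa only [← Complex.coe_smul, Complex.ofReal_natCast] using card_smul_sum_twirl M
  rw [← Finset.smul_sum, inv_smul_eq_iff₀ hX, smul_comm, ← hsum, inv_smul_smul₀ hA]

end Twirl

section KleinInequality

variable {n : Type*} [Fintype n] [DecidableEq n] {M N : Matrix n n ℂ}

theorem cfc_eq_eigenvectorUnitary_mul (hM : M.IsHermitian) (f : ℝ → ℝ) :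
    cfc f M = (hM.eigenvectorUnitary : Matrix n n ℂ) *
      Matrix.diagonal (fun i => (f (hM.eigenvalues i) : ℂ)) *
        (hM.eigenvectorUnitary : Matrix n n ℂ)ᴴ := by
  rw [hM.cfc_eq]
  rfl

theorem trace_re_diagonal_mul_mul_diagonal_mul (a b : n → ℝ) (Q : Matrix n n ℂ) :
    (Matrix.diagonal (fun i => (a i : ℂ)) * Q * Matrix.diagonal (fun j => (b j : ℂ)) *
      Qᴴ).trace.re = ∑ i, ∑ j, Complex.normSq (Q i j) * (a i * b j) := by
  rw [Matrix.trace, Complex.re_sum]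
  refine Finset.sum_congr rfl fun i _ => ?_
  rw [Matrix.diag_apply, Matrix.mul_apply, Complex.re_sum]
  refine Finset.sum_congr rfl fun j _ => ?_
  rw [Matrix.mul_diagonal, Matrix.diagonal_mul, Matrix.conjTranspose_apply, Complex.star_def,
    ← Complex.ofReal_re (Complex.normSq (Q i j) * (a i * b j))]
  push_cast
  rw [Complex.normSq_eq_conj_mul_self]
  ring_nf

theorem trace_re_cfc_mul_cfc (hM : M.IsHermitian) (hN : N.IsHermitian) (f g : ℝ → ℝ) :
    (cfc f M * cfc g N).trace.re = ∑ i, ∑ j,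
      Complex.normSq (((hM.eigenvectorUnitary : Matrix n n ℂ)ᴴ * hN.eigenvectorUnitary) i j) *
        (f (hM.eigenvalues i) * g (hN.eigenvalues j)) := by
  rw [← trace_re_diagonal_mul_mul_diagonal_mul, cfc_eq_eigenvectorUnitary_mul hM,
    cfc_eq_eigenvectorUnitary_mul hN, Matrix.conjTranspose_mul,
    Matrix.conjTranspose_conjTranspose, Matrix.mul_assoc _ _ (_)ᴴ, Matrix.mul_assoc _ (_ * (_)ᴴ),
    Matrix.trace_mul_comm]
  simp only [Matrix.mul_assoc]

theorem sum_trace_re_cfc_mul_cfc_nonneg (hM : M.IsHermitian) (hN : N.IsHermitian) {ι : Type*}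
    [Fintype ι] (f g : ι → ℝ → ℝ)
    (h : ∀ s ∈ spectrum ℝ M, ∀ t ∈ spectrum ℝ N, 0 ≤ ∑ k, f k s * g k t) :
    0 ≤ ∑ k, (cfc (f k) M * cfc (g k) N).trace.re := by
  simp only [trace_re_cfc_mul_cfc hM hN]
  rw [Finset.sum_comm]
  refine Finset.sum_nonneg fun i _ => ?_
  rw [Finset.sum_comm]
  refine Finset.sum_nonneg fun j _ => ?_
  rw [← Finset.mul_sum]
  exact mul_nonneg (Complex.normSq_nonneg _)
    (h _ (hM.eigenvalues_mem_spectrum_real i) _ (hN.eigenvalues_mem_spectrum_real j))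

theorem sub_le_mul_log_sub_log {s t : ℝ} (hs : 0 ≤ s) (ht : 0 < t) :
    s - t ≤ s * (Real.log s - Real.log t) := by
  rcases hs.eq_or_lt with rfl | hs
  · simpa using ht.le
  have hlog := Real.one_sub_inv_le_log_of_pos (div_pos hs ht)
  rw [Real.log_div hs.ne' ht.ne', inv_div] at hlog
  calc s - t = s * (1 - t / s) := by field_simp
    _ ≤ s * (Real.log s - Real.log t) := by gcongr

theorem mul_log_sub_log_le {s t : ℝ} (hs : 0 ≤ s) (ht : 0 < t) :
    s * (Real.log s - Real.log t) ≤ s * s * t⁻¹ - s := by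
  rcases hs.eq_or_lt with rfl | hs
  · simp
  have hlog := Real.log_le_sub_one_of_pos (div_pos hs ht)
  rw [Real.log_div hs.ne' ht.ne'] at hlog
  calc s * (Real.log s - Real.log t) ≤ s * (s / t - 1) := by gcongr
    _ = s * s * t⁻¹ - s := by ring

theorem trace_sub_trace_le_umegaki (hM : M.PosSemidef) (hN : N.PosDef) :
    M.trace.re - N.trace.re ≤ umegaki M N := by
  have hsum := sum_trace_re_cfc_mul_cfc_nonneg hM.1 hN.1
    ![fun s => s * Real.log s, id, id, fun _ => 1]
    ![fun _ => 1, fun t => -Real.log t, fun _ => -1, id] fun s hs t ht => by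
      have := sub_le_mul_log_sub_log (spectrum_nonneg_of_posSemidef hM hs)
        (spectrum_pos_of_posDef hN ht)
      simp only [Fin.sum_univ_four, Matrix.cons_val, id]
      linarith
  have hMa := hM.1.isSelfAdjoint
  have hNa := hN.1.isSelfAdjoint
  simp only [Fin.sum_univ_four, Matrix.cons_val, cfc_neg, cfc_id ℝ M hMa, cfc_id ℝ N hNa,
    cfc_const_one ℝ M hMa, cfc_const_one ℝ N hNa, ← mul_cfc hM.1, Matrix.mul_neg, Matrix.mul_one,
    Matrix.one_mul, Matrix.trace_neg, Complex.neg_re] at hsum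
  rw [umegaki_eq_sub, mlog, mlog]
  linarith

theorem umegaki_le_trace_mul_pinv (hM : M.PosSemidef) (hN : N.PosDef) :
    umegaki M N ≤ (M * M * pinv N).trace.re - M.trace.re := by
  have hsum := sum_trace_re_cfc_mul_cfc_nonneg hM.1 hN.1
    ![fun s => s * id s, id, fun s => s * Real.log s, id]
    ![fun t => t⁻¹, fun _ => -1, fun _ => -1, Real.log] fun s hs t ht => by
      have := mul_log_sub_log_le (spectrum_nonneg_of_posSemidef hM hs)
        (spectrum_pos_of_posDef hN ht)
      simp only [Fin.sum_univ_four, Matrix.cons_val, id]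
      linarith
  have hMa := hM.1.isSelfAdjoint
  have hNa := hN.1.isSelfAdjoint
  simp only [Fin.sum_univ_four, Matrix.cons_val, cfc_neg, cfc_id ℝ M hMa,
    cfc_const_one ℝ N hNa, ← mul_cfc hM.1, Matrix.mul_neg, Matrix.mul_one, Matrix.trace_neg,
    Complex.neg_re] at hsum
  rw [umegaki_eq_sub, mlog, mlog, pinv]
  linarith

end KleinInequality

section BuresNonneg

variable {n : Type*} [Fintype n] [DecidableEq n]

/-- The partial isometry `M (Mᴴ M)^{-1/2}` of the polar decomposition of `M`. -/
def polarFactor (M : Matrix n n ℂ) : Matrix n n ℂ := M * minvsqrt (Mᴴ * M)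

theorem conjTranspose_polarFactor_mul (M : Matrix n n ℂ) :
    (polarFactor M)ᴴ * M = msqrt (Mᴴ * M) := by
  rw [polarFactor, Matrix.conjTranspose_mul, (isHermitian_minvsqrt _).eq, Matrix.mul_assoc,
    minvsqrt_mul_self (Matrix.isHermitian_conjTranspose_mul_self M)]

theorem polarFactor_mul_conjTranspose_mul_polarFactor (M : Matrix n n ℂ) :
    polarFactor M * (polarFactor M)ᴴ * polarFactor M = polarFactor M := by
  have hK := Matrix.posSemidef_conjTranspose_mul_self M
  calc polarFactor M * (polarFactor M)ᴴ * polarFactor M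
      = polarFactor M * ((polarFactor M)ᴴ * M * minvsqrt (Mᴴ * M)) := by
        rw [polarFactor]
        simp only [Matrix.mul_assoc]
    _ = polarFactor M * (1 - kerProj (Mᴴ * M)) := by
        rw [conjTranspose_polarFactor_mul, msqrt_mul_minvsqrt hK]
    _ = polarFactor M := by
        rw [Matrix.mul_sub, Matrix.mul_one, polarFactor, Matrix.mul_assoc, minvsqrt_mul_kerProj,
          Matrix.mul_zero, sub_zero]

theorem posSemidef_one_sub_polarFactor (M : Matrix n n ℂ) :
    (1 - polarFactor M * (polarFactor M)ᴴ).PosSemidef := by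
  set Q := 1 - polarFactor M * (polarFactor M)ᴴ with hQ
  have hadj : Qᴴ = Q := by
    simp only [hQ, Matrix.conjTranspose_sub, Matrix.conjTranspose_one, Matrix.conjTranspose_mul,
      Matrix.conjTranspose_conjTranspose]
  have hidem : Qᴴ * Q = Q := by
    rw [hadj, hQ, Matrix.mul_sub, Matrix.mul_one, Matrix.sub_mul, Matrix.one_mul,
      ← Matrix.mul_assoc, polarFactor_mul_conjTranspose_mul_polarFactor, sub_self, sub_zero]
  exact hidem ▸ Matrix.posSemidef_conjTranspose_mul_self Q

theorem two_mul_traceNorm_mul_le (S T : Matrix n n ℂ) :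
    2 * traceNorm (S * T) ≤ (S * Sᴴ).trace.re + (Tᴴ * T).trace.re := by
  set W := polarFactor (S * T)
  have hnonneg {Q : Matrix n n ℂ} (hQ : Q.PosSemidef) : 0 ≤ Q.trace.re :=
    (Complex.nonneg_iff.1 hQ.trace_nonneg).1
  have hnorm : traceNorm (S * T) = (Wᴴ * S * T).trace.re := by
    rw [traceNorm, ← conjTranspose_polarFactor_mul, Matrix.mul_assoc]
  have hnorm' : (Tᴴ * Sᴴ * W).trace.re = (Wᴴ * S * T).trace.re := by
    rw [← Complex.conj_re, ← Complex.star_def, ← Matrix.trace_conjTranspose]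
    simp only [Matrix.conjTranspose_mul, Matrix.conjTranspose_conjTranspose, Matrix.mul_assoc]
  have hcontr : (Wᴴ * S * Sᴴ * W).trace.re ≤ (S * Sᴴ).trace.re := by
    have := hnonneg ((posSemidef_one_sub_polarFactor (S * T)).conjTranspose_mul_mul_same S)
    rw [Matrix.trace_mul_comm, ← Matrix.mul_assoc, Matrix.mul_sub, Matrix.mul_one,
      Matrix.trace_sub, Complex.sub_re, ← Matrix.mul_assoc, Matrix.trace_mul_comm _ Wᴴ] at this
    simpa only [Matrix.mul_assoc, sub_nonneg] using this
  have hsq := hnonneg (Matrix.posSemidef_conjTranspose_mul_self (Sᴴ * W - T))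
  simp only [Matrix.conjTranspose_sub, Matrix.conjTranspose_mul,
    Matrix.conjTranspose_conjTranspose, Matrix.sub_mul, Matrix.mul_sub, Matrix.trace_sub,
    Complex.sub_re, ← Matrix.mul_assoc, hnorm'] at hsq
  linarith

theorem buresSq_nonneg {τ ς : Matrix n n ℂ} (hτ : IsDensity τ) (hς : IsDensity ς) :
    0 ≤ buresSq τ ς := by
  have hAMGM := two_mul_traceNorm_mul_le (msqrt τ) (msqrt ς)
  rw [(isHermitian_msqrt τ).eq, (isHermitian_msqrt ς).eq, msqrt_mul_self hτ.1,
    msqrt_mul_self hς.1, hτ.2, hς.2, Complex.one_re] at hAMGM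
  rw [buresSq_eq]
  linarith

end BuresNonneg

section Limits

open Filter Topology

variable {n A B ι : Type*} [Fintype n] {l : Filter ι}

theorem tendsto_trace_re {M : ι → Matrix n n ℂ} {M₀ : Matrix n n ℂ} (hM : Tendsto M l (𝓝 M₀)) :
    Tendsto (fun i => (M i).trace.re) l (𝓝 M₀.trace.re) :=
  (Complex.continuous_re.comp continuous_id.matrix_trace).continuousAt.tendsto.comp hM

variable [DecidableEq n]

open scoped Matrix.Norms.L2Operator in
theorem tendsto_cfc_of_isOpen {M : ι → Matrix n n ℂ} {M₀ : Matrix n n ℂ}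
    (hM : Tendsto M l (𝓝 M₀)) (hM' : ∀ i, (M i).IsHermitian) (hM₀ : M₀.IsHermitian) {f : ℝ → ℝ}
    {s : Set ℝ} (hs : IsOpen s) (hspec : spectrum ℝ M₀ ⊆ s) (hf : ContinuousOn f s) :
    Tendsto (fun i => cfc f (M i)) l (𝓝 (cfc f M₀)) := by
  have hcompact : IsCompact (spectrum ℝ M₀) := M₀.finite_real_spectrum.isCompact
  obtain ⟨k, ⟨hk_mem, hk⟩, hks⟩ := hcompact.nhdsSet_basis_isCompact.mem_iff.mp
    (hs.mem_nhdsSet.2 hspec)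
  have hupper := (upperHemicontinuous_spectrum ℝ (Matrix n n ℂ)).isOpen k
  have hspec' : ∀ᶠ i in l, spectrum ℝ (M i) ⊆ k :=
    (hM.eventually (hupper.mem_nhds hk_mem)).mono fun _ hi => subset_of_mem_nhdsSet hi
  exact hM.cfc hk f hspec' (Eventually.of_forall fun i => (hM' i).isSelfAdjoint)
    (subset_of_mem_nhdsSet hk_mem) hM₀.isSelfAdjoint (hf.mono hks)

theorem tendsto_msqrt {M : ι → Matrix n n ℂ} {M₀ : Matrix n n ℂ} (hM : Tendsto M l (𝓝 M₀))
    (hM' : ∀ i, (M i).IsHermitian) (hM₀ : M₀.IsHermitian) :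
    Tendsto (fun i => msqrt (M i)) l (𝓝 (msqrt M₀)) :=
  tendsto_cfc_of_isOpen hM hM' hM₀ isOpen_univ (Set.subset_univ _)
    Real.continuous_sqrt.continuousOn

theorem tendsto_cfc_of_posDef {M : ι → Matrix n n ℂ} {M₀ : Matrix n n ℂ}
    (hM : Tendsto M l (𝓝 M₀)) (hM' : ∀ i, (M i).IsHermitian) (hM₀ : M₀.PosDef) {f : ℝ → ℝ}
    (hf : ContinuousOn f (Set.Ioi 0)) : Tendsto (fun i => cfc f (M i)) l (𝓝 (cfc f M₀)) :=
  tendsto_cfc_of_isOpen hM hM' hM₀.1 isOpen_Ioi (fun _ ht => spectrum_pos_of_posDef hM₀ ht) hf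

theorem tendsto_mlog {M : ι → Matrix n n ℂ} {M₀ : Matrix n n ℂ} (hM : Tendsto M l (𝓝 M₀))
    (hM' : ∀ i, (M i).IsHermitian) (hM₀ : M₀.PosDef) :
    Tendsto (fun i => mlog (M i)) l (𝓝 (mlog M₀)) :=
  tendsto_cfc_of_posDef hM hM' hM₀ (Real.continuousOn_log.mono fun _ ht => ne_of_gt ht)

theorem tendsto_minvsqrt {M : ι → Matrix n n ℂ} {M₀ : Matrix n n ℂ} (hM : Tendsto M l (𝓝 M₀))
    (hM' : ∀ i, (M i).IsHermitian) (hM₀ : M₀.PosDef) :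
    Tendsto (fun i => minvsqrt (M i)) l (𝓝 (minvsqrt M₀)) :=
  tendsto_cfc_of_posDef hM hM' hM₀ (Real.continuous_sqrt.continuousOn.inv₀
    fun _ ht => (Real.sqrt_pos.2 ht).ne')

theorem tendsto_pinv {M : ι → Matrix n n ℂ} {M₀ : Matrix n n ℂ} (hM : Tendsto M l (𝓝 M₀))
    (hM' : ∀ i, (M i).IsHermitian) (hM₀ : M₀.PosDef) :
    Tendsto (fun i => pinv (M i)) l (𝓝 (pinv M₀)) :=
  tendsto_cfc_of_posDef hM hM' hM₀ (continuousOn_id.inv₀ fun _ ht => ne_of_gt ht)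

theorem tendsto_buresSq (τ : Matrix n n ℂ) {M : ι → Matrix n n ℂ} {M₀ : Matrix n n ℂ}
    (hM : Tendsto M l (𝓝 M₀)) (hM' : ∀ i, (M i).IsHermitian) (hM₀ : M₀.IsHermitian) :
    Tendsto (fun i => buresSq τ (M i)) l (𝓝 (buresSq τ M₀)) := by
  simp only [buresSq_eq, traceNorm]
  have hprod := (tendsto_const_nhds (x := msqrt τ)).mul (tendsto_msqrt hM hM' hM₀)
  have hsq := (continuous_id.matrix_conjTranspose.continuousAt.tendsto.comp hprod).mul hprod
  exact ((tendsto_trace_re (tendsto_msqrt hsq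
    (fun _ => Matrix.isHermitian_conjTranspose_mul_self _)
    (Matrix.isHermitian_conjTranspose_mul_self _))).const_sub 1).const_mul 2

theorem tendsto_umegaki_right (ρ : Matrix n n ℂ) {τ : ι → Matrix n n ℂ} {σ : Matrix n n ℂ}
    (h : Tendsto (fun i => mlog (τ i)) l (𝓝 (mlog σ))) :
    Tendsto (fun i => umegaki ρ (τ i)) l (𝓝 (umegaki ρ σ)) :=
  tendsto_trace_re (tendsto_const_nhds.mul (h.const_sub _))

theorem continuous_trLeft {A B : Type u} [Fintype A] :
    Continuous (trLeft : Matrix (A × B) (A × B) ℂ → Matrix B B ℂ) :=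
  continuous_matrix fun _ _ => continuous_finsetSum _ fun _ _ => continuous_id.matrix_elem _ _

theorem continuous_one_kronecker [DecidableEq A] :
    Continuous fun M : Matrix B B ℂ => (1 : Matrix A A ℂ) ⊗ₖ M :=
  continuous_matrix fun _ _ => continuous_const.mul (continuous_id.matrix_elem _ _)

theorem tendsto_petzPartialTrace {A B : Type u} [Fintype A] [DecidableEq A] [Fintype B]
    [DecidableEq B] {τ : ι → Matrix (A × B) (A × B) ℂ} {σ : Matrix (A × B) (A × B) ℂ}
    (hτ : Tendsto τ l (𝓝 σ)) (hτ' : ∀ i, (τ i).IsHermitian) (hσ : σ.IsHermitian)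
    (hσB : (trLeft σ).PosDef) (Y : Matrix B B ℂ) :
    Tendsto (fun i => petzPartialTrace (τ i) Y) l (𝓝 (petzPartialTrace σ Y)) := by
  have hsqrt := tendsto_msqrt hτ hτ' hσ
  have hinv := tendsto_minvsqrt ((continuous_trLeft.tendsto σ).comp hτ)
    (fun i => isHermitian_trLeft (hτ' i)) hσB
  exact (hsqrt.mul ((continuous_one_kronecker.tendsto _).comp ((hinv.mul_const Y).mul hinv))).mul
    hsqrt

end Limits

section Mixture

open Filter Topology

variable {n : Type*}

theorem lineMap_add_right {V : Type*} [AddCommGroup V] [Module ℝ V] (v w u : V) (t : ℝ) :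
    AffineMap.lineMap v w t + u = AffineMap.lineMap (v + u) (w + u) t := by
  simp only [AffineMap.lineMap_apply_module, smul_add, sub_smul, one_smul]
  abel

theorem isHermitian_lineMap {σ ρ : Matrix n n ℂ} (hσ : σ.IsHermitian) (hρ : ρ.IsHermitian)
    (t : ℝ) : (AffineMap.lineMap σ ρ t).IsHermitian := by
  rw [AffineMap.lineMap_apply_module]
  exact (isHermitian_real_smul hσ _).add (isHermitian_real_smul hρ _)

theorem posDef_lineMap {σ ρ : Matrix n n ℂ} (hσ : σ.PosDef) (hρ : ρ.PosSemidef) {t : ℝ}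
    (h0 : 0 ≤ t) (h1 : t < 1) : (AffineMap.lineMap σ ρ t).PosDef := by
  rw [AffineMap.lineMap_apply_module]
  exact (hσ.smul (sub_pos.2 h1)).add_posSemidef (hρ.smul h0)

theorem tendsto_lineMap (σ ρ : Matrix n n ℂ) :
    Tendsto (AffineMap.lineMap σ ρ : ℝ → Matrix n n ℂ) (𝓝[>] 0) (𝓝 σ) := by
  have hcont : Continuous fun t : ℝ => AffineMap.lineMap σ ρ t := by
    simp only [AffineMap.lineMap_apply_module]
    fun_prop
  simpa only [AffineMap.lineMap_apply_zero] using
    (hcont.tendsto 0).mono_left (nhdsWithin_le_nhds (s := Set.Ioi 0))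

variable [Fintype n] [DecidableEq n]

theorem posDef_add_kerProj {M : Matrix n n ℂ} (hM : M.PosSemidef) :
    (M + kerProj M).PosDef := by
  refine ((hM.add (posSemidef_kerProj M)).posDef_iff_isUnit).2 (IsUnit.of_mul_eq_one
    (pinv M + kerProj M) ?_)
  have hpinv : kerProj M * pinv M = 0 := by
    rw [pinv, kerProj, cfc_mul_cfc, ← cfc_const_zero ℝ M]
    exact cfc_congr fun t _ => by by_cases ht : t = 0 <;> simp [ht]
  rw [Matrix.add_mul, Matrix.mul_add, Matrix.mul_add, mul_pinv hM.1, mul_kerProj hM.1, hpinv,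
    kerProj_mul_self, add_zero, zero_add, sub_add_cancel]

variable {σ ρ : Matrix n n ℂ}

theorem mlog_lineMap_add_kerProj (hσ : σ.IsHermitian) (hρ : ρ.IsHermitian)
    (h : supp ρ ≤ supp σ) (t : ℝ) :
    mlog (AffineMap.lineMap σ ρ t + kerProj σ) = mlog (AffineMap.lineMap σ ρ t) := by
  refine cfc_add_orthogonal_projection (isHermitian_lineMap hσ hρ t) (isHermitian_kerProj σ)
    (kerProj_mul_self σ) ?_ Real.log_zero Real.log_one
  rw [AffineMap.lineMap_apply_module, Matrix.add_mul, Matrix.smul_mul, Matrix.smul_mul,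
    mul_kerProj hσ, (supp_le_supp_iff_mul_kerProj_eq_zero hρ hσ).1 h, smul_zero, smul_zero,
    add_zero]

theorem tendsto_mlog_lineMap (hσ : σ.PosSemidef) (hρ : ρ.IsHermitian) (h : supp ρ ≤ supp σ) :
    Tendsto (fun t : ℝ => mlog (AffineMap.lineMap σ ρ t)) (𝓝[>] 0) (𝓝 (mlog σ)) := by
  have hshift := tendsto_mlog (tendsto_lineMap (σ + kerProj σ) (ρ + kerProj σ))
    (isHermitian_lineMap (posDef_add_kerProj hσ).1 (hρ.add (isHermitian_kerProj σ)))
    (posDef_add_kerProj hσ)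
  have hend : mlog (σ + kerProj σ) = mlog σ := by
    simpa only [AffineMap.lineMap_apply_zero] using mlog_lineMap_add_kerProj hσ.1 hρ h 0
  simpa only [← lineMap_add_right, mlog_lineMap_add_kerProj hσ.1 hρ h, hend] using hshift

theorem umegaki_lineMap_le (hσ : σ.PosSemidef) (hρ : ρ.PosSemidef) (h : supp ρ ≤ supp σ)
    {t : ℝ} (h0 : 0 ≤ t) (h1 : t < 1) :
    umegaki σ (AffineMap.lineMap σ ρ t) ≤
      t * (σ * (σ - ρ) * pinv (AffineMap.lineMap σ ρ t + kerProj σ)).trace.re := by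
  have hpos : (AffineMap.lineMap σ ρ t + kerProj σ).PosDef := by
    rw [lineMap_add_right]
    exact posDef_lineMap (posDef_add_kerProj hσ) (hρ.add (posSemidef_kerProj σ)) h0 h1
  have hchi := umegaki_le_trace_mul_pinv hσ hpos
  have hsplit : σ * σ =
      σ * (AffineMap.lineMap σ ρ t + kerProj σ) + t • (σ * (σ - ρ)) := by
    rw [Matrix.mul_add, mul_kerProj hσ.1, AffineMap.lineMap_apply_module, Matrix.mul_add,
      Matrix.mul_smul, Matrix.mul_smul, Matrix.mul_sub, smul_sub, sub_smul, one_smul]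
    abel
  rw [hsplit, Matrix.add_mul, Matrix.mul_assoc σ _ (pinv _), mul_pinv_of_posDef hpos,
    Matrix.mul_one, Matrix.smul_mul, Matrix.trace_add, Complex.add_re, add_sub_cancel_left,
    Matrix.trace_smul, Complex.smul_re, smul_eq_mul] at hchi
  rwa [umegaki, mlog_lineMap_add_kerProj hσ.1 hρ.1 h] at hchi

theorem pinv_add_kerProj_mul (hσ : σ.PosSemidef) :
    pinv (σ + kerProj σ) * σ = 1 - kerProj σ := by
  have hcompl : (σ + kerProj σ) * (1 - kerProj σ) = σ := by
    rw [Matrix.mul_sub, Matrix.mul_one, Matrix.add_mul, mul_kerProj hσ.1, kerProj_mul_self,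
      zero_add, add_sub_cancel_right]
  calc pinv (σ + kerProj σ) * σ = pinv (σ + kerProj σ) * (σ + kerProj σ) * (1 - kerProj σ) := by
        rw [Matrix.mul_assoc, hcompl]
    _ = 1 - kerProj σ := by
        rw [mul_eq_one_comm.1 (mul_pinv_of_posDef (posDef_add_kerProj hσ)), Matrix.one_mul]

theorem tendsto_trace_mul_pinv_lineMap (hσ : σ.PosSemidef) (hρ : ρ.IsHermitian)
    (h : supp ρ ≤ supp σ) (htr : σ.trace = ρ.trace) :
    Tendsto (fun t : ℝ => (σ * (σ - ρ) * pinv (AffineMap.lineMap σ ρ t + kerProj σ)).trace.re)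
      (𝓝[>] 0) (𝓝 0) := by
  have hpinv := tendsto_pinv ((tendsto_lineMap σ ρ).add_const (kerProj σ))
    (fun t => (isHermitian_lineMap hσ.1 hρ t).add (isHermitian_kerProj σ))
    (posDef_add_kerProj hσ)
  have hlim := tendsto_trace_re (hpinv.const_mul (σ * (σ - ρ)))
  have hzero : (σ * (σ - ρ) * pinv (σ + kerProj σ)).trace = 0 := by
    rw [Matrix.trace_mul_comm, ← Matrix.mul_assoc, pinv_add_kerProj_mul hσ,
      Matrix.trace_mul_comm, Matrix.mul_sub, Matrix.sub_mul _ _ (kerProj σ), mul_kerProj hσ.1,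
      (supp_le_supp_iff_mul_kerProj_eq_zero hρ hσ.1).1 h, sub_zero, sub_zero, Matrix.mul_one,
      Matrix.trace_sub, htr, sub_self]
  rwa [hzero, Complex.zero_re] at hlim

end Mixture

section StrongSubadditivity

variable {A B C X : Type u} [Fintype A] [DecidableEq A] [Fintype B] [DecidableEq B]

theorem MonotonicityPartialTrace.buresSq_le_umegaki_sub (h : MonotonicityPartialTrace.{u})
    {ρ T : Matrix (A × B) (A × B) ℂ} (hρ : IsDensity ρ) (hT : T.PosSemidef)
    (hsupp : supp ρ ≤ supp T) (hTB : (trLeft T).PosDef) :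
    buresSq ρ (petzPartialTrace T (trLeft ρ)) ≤
      umegaki ρ T - umegaki (trLeft ρ) (trLeft T) := by
  have hne : Nonempty B := hρ.nonempty.map Prod.snd
  have htr : 0 < T.trace := trace_trLeft T ▸ hTB.trace_pos
  obtain ⟨htr_re, htr_im⟩ := Complex.pos_iff.1 htr
  set c : ℝ := T.trace.re⁻¹ with hc_def
  have hc : 0 < c := inv_pos.2 htr_re
  have hσ : IsDensity (c • T) := by
    refine ⟨hT.smul hc.le, ?_⟩
    rw [Matrix.trace_smul, hc_def]
    apply Complex.ext
    · simpa using inv_mul_cancel₀ htr_re.ne'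
    · simp [← htr_im]
  have hsuppB := supp_le_supp_of_posDef (trLeft ρ) hTB
  have key := h A B ρ (c • T) hρ hσ (supp_le_supp_smul hc.ne' hsupp)
    (by rw [trLeft_smul]; exact hTB.smul hc)
  rw [relEntropy_sub_relEntropy (supp_le_supp_smul hc.ne' hsupp)
      (supp_le_supp_of_posDef _ (by rw [trLeft_smul]; exact hTB.smul hc)),
    EReal.coe_le_coe_iff, petzPartialTrace_smul_left hc hT.1, trLeft_smul,
    umegaki_smul_right hc.ne' hρ.1.1 hT.1 hsupp,
    umegaki_smul_right hc.ne' (isHermitian_trLeft hρ.1.1) hTB.1 hsuppB, trace_trLeft,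
    sub_sub_sub_cancel_right] at key
  exact key

variable [Fintype C] [DecidableEq C]

theorem petzPartialTrace_tensorIdMiddle_trMiddle {ω : Matrix (A × B × C) (A × B × C) ℂ}
    (hω : ω.IsHermitian) (Y : Matrix (B × C) (B × C) ℂ) :
    petzPartialTrace (tensorIdMiddle B (trMiddle ω)) Y = petzCtoAC ω Y := by
  have hAC : (trMiddle ω).IsHermitian := by
    rw [trMiddle_eq_trLeft]
    exact isHermitian_trLeft (hω.submatrix _)
  have hC : (trLeft (trLeft ω)).IsHermitian := isHermitian_trLeft (isHermitian_trLeft hω)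
  have hK : minvsqrt ((1 : Matrix B B ℂ) ⊗ₖ trLeft (trLeft ω)) =
      1 ⊗ₖ minvsqrt (trLeft (trLeft ω)) := cfc_one_kronecker hC _
  rw [petzPartialTrace, petzCtoAC, trLeft_tensorIdMiddle, trLeft_trMiddle, hK,
    tensorIdMiddle_eq_blockOp, msqrt_blockOp _ fun _ => hAC, ← tensorIdMiddle_eq_blockOp]

theorem MonotonicityPartialTrace.strongSubadditivity (h : MonotonicityPartialTrace.{u}) :
    StrongSubadditivity.{u} := by
  intro A B C _ _ _ _ _ _ ω hω hC
  have hT : (tensorIdMiddle B (trMiddle ω)).PosSemidef := by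
    rw [tensorIdMiddle_eq_blockOp]
    exact posSemidef_blockOp _ fun _ => posSemidef_trMiddle hω.1
  have hsupp := supp_le_supp_tensorIdMiddle_trMiddle hω.1
  have hTB : trLeft (tensorIdMiddle B (trMiddle ω)) = 1 ⊗ₖ trLeft (trLeft ω) := by
    rw [trLeft_tensorIdMiddle, trLeft_trMiddle]
  have hBC : ((1 : Matrix B B ℂ) ⊗ₖ trLeft (trLeft ω)).PosDef := Matrix.PosDef.one.kronecker hC
  have key := h.buresSq_le_umegaki_sub hω hT hsupp (hTB ▸ hBC)
  rw [petzPartialTrace_tensorIdMiddle_trMiddle hω.1.1, hTB] at key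
  rw [condMutualInfo, relEntropy_sub_relEntropy hsupp (supp_le_supp_of_posDef _ hBC)]
  exact EReal.coe_le_coe_iff.2 key

theorem petzCtoAC_blockOp (M : B → Matrix (A × C) (A × C) ℂ) (Y : B → Matrix C C ℂ) :
    petzCtoAC (blockOp (midEquiv A B C) M) (blockOp (Equiv.prodComm B C) Y) =
      blockOp (midEquiv A B C) fun b => petzPartialTrace (∑ b, M b) (Y b) := by
  simp only [petzCtoAC, petzPartialTrace, ← trLeft_trMiddle, trMiddle_blockOp]
  rw [tensorIdMiddle_eq_blockOp, one_kronecker_eq_blockOp (minvsqrt _), blockOp_mul, blockOp_mul,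
    one_kronecker_blockOp, blockOp_mul, blockOp_mul]

theorem condMutualInfo_blockOp [Fintype X] [DecidableEq X] {p : X → ℝ} (hp : IsProb p)
    {ρ : X → Matrix (A × B) (A × B) ℂ} (hρ : ∀ x, IsDensity (ρ x))
    (hB : (trLeft (∑ y, p y • ρ y)).PosDef) :
    condMutualInfo (blockOp (midEquiv A X B) fun x => p x • ρ x) =
      condEntropy (∑ y, p y • ρ y) - ∑ x, (p x : EReal) * condEntropy (ρ x) := by
  have hτ : IsDensity (∑ y, p y • ρ y) := IsDensity.average hp hρ
  have hρB (x) : (trLeft (ρ x)).IsHermitian := isHermitian_trLeft (hρ x).1.1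
  have hω : IsDensity (blockOp (midEquiv A X B) fun x => p x • ρ x) := isDensity_blockOp _ hp hρ
  have hsupp := supp_le_supp_tensorIdMiddle_trMiddle hω.1
  rw [trMiddle_blockOp] at hsupp
  rw [condMutualInfo, ← trLeft_trMiddle, trMiddle_blockOp, relEntropy_sub_relEntropy hsupp
      (supp_le_supp_of_posDef _ (Matrix.PosDef.one.kronecker hB)),
    condEntropy_sub_sum_condEntropy hp hρ, trLeft_blockOp_midEquiv, tensorIdMiddle_eq_blockOp,
    one_kronecker_eq_blockOp, umegaki_blockOp _ (fun x => isHermitian_real_smul (hρ x).1.1 _)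
      (fun _ => hτ.1.1)]
  simp only [trLeft_smul]
  rw [umegaki_blockOp _ (fun x => isHermitian_real_smul (hρB x) _) (fun _ => hB.1),
    ← Finset.sum_sub_distrib, ← Finset.sum_sub_distrib]
  congr 1
  refine Finset.sum_congr rfl fun x _ => ?_
  rw [umegaki_smul_left _ (hρ x).1.1, umegaki_smul_left _ (hρB x), trace_trLeft,
    add_sub_add_right_eq_sub]

theorem StrongSubadditivity.concavityCondEntropy (h : StrongSubadditivity.{u}) :
    ConcavityCondEntropy.{u} := by
  classical
  intro X A B _ _ _ _ _ p ρ hp hρ hB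
  have hω : IsDensity (blockOp (midEquiv A X B) fun x => p x • ρ x) := isDensity_blockOp _ hp hρ
  have key := h A X B _ hω (by rwa [← trLeft_trMiddle, trMiddle_blockOp])
  rw [trLeft_blockOp_midEquiv, petzCtoAC_blockOp, condMutualInfo_blockOp hp hρ hB] at key
  simp only [trLeft_smul, petzPartialTrace_smul_right] at key
  rwa [buresSq_blockOp _ hp (fun x => (hρ x).1.1) fun x =>
    isHermitian_petzPartialTrace _ (isHermitian_trLeft (hρ x).1.1)] at key

end StrongSubadditivity

section JointConvexity

variable {A B S X : Type u} [Fintype A] [DecidableEq A] [Fintype B] [DecidableEq B]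
  [Fintype S] [DecidableEq S] [Fintype X] [DecidableEq X]

theorem petzPartialTrace_blockOp {p : X → ℝ} (hp : ∀ x, 0 ≤ p x) {σ : X → Matrix S S ℂ}
    (hσ : ∀ x, (σ x).IsHermitian) (Y : Matrix S S ℂ) :
    petzPartialTrace (blockOp (Equiv.prodComm X S) fun x => p x • σ x) Y =
      blockOp (Equiv.prodComm X S) fun x => p x •
        (msqrt (σ x) * (minvsqrt (∑ y, p y • σ y) * Y * minvsqrt (∑ y, p y • σ y)) *
          msqrt (σ x)) := by
  rw [petzPartialTrace, trLeft_blockOp, one_kronecker_eq_blockOp,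
    msqrt_blockOp _ fun x => isHermitian_real_smul (hσ x) (p x), blockOp_mul, blockOp_mul]
  congr 1
  funext x
  rw [msqrt_smul (hp x) (hσ x), Matrix.smul_mul, Matrix.smul_mul, Matrix.mul_smul, smul_smul,
    Real.mul_self_sqrt (hp x)]

theorem MonotonicityPartialTrace.jointConvexity (h : MonotonicityPartialTrace.{u}) :
    JointConvexity.{u} := by
  classical
  intro X S _ _ _ p ρ σ hp hρ hσ hsupp hpos
  have hsupp_block : supp (blockOp (Equiv.prodComm X S) fun x => p x • ρ x) ≤
      supp (blockOp (Equiv.prodComm X S) fun x => p x • σ x) :=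
    supp_blockOp_le _ fun x => supp_smul_le_supp_smul (p x) (hsupp x)
  have hρ_avg : (∑ y, p y • ρ y).IsHermitian := (IsDensity.average hp hρ).1.1
  have key := h X S _ _ (isDensity_blockOp _ hp hρ) (isDensity_blockOp _ hp hσ) hsupp_block
    (by rwa [trLeft_blockOp])
  rw [trLeft_blockOp, trLeft_blockOp, petzPartialTrace_blockOp hp.1 fun x => (hσ x).1.1,
    buresSq_blockOp _ hp (fun x => (hρ x).1.1) fun x =>
      isHermitian_mul_mul_self (isHermitian_msqrt _)
        (isHermitian_mul_mul_self (isHermitian_minvsqrt _) hρ_avg),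
    relEntropy_eq hsupp_block, umegaki_blockOp _ (fun x => isHermitian_real_smul (hρ x).1.1 _)
      (fun x => isHermitian_real_smul (hσ x).1.1 _)] at key
  simpa only [umegaki_smul_smul _ (hρ _).1.1 (hσ _).1.1 (hsupp _), ereal_coe_sum,
    EReal.coe_mul, relEntropy_eq (hsupp _), Matrix.mul_assoc] using key

theorem minvsqrt_smul_mul_smul_mul_minvsqrt_smul {c : ℝ} (hc : 0 < c) {M : Matrix S S ℂ}
    (hM : M.IsHermitian) (N : Matrix S S ℂ) :
    minvsqrt (c • M) * (c • N) * minvsqrt (c • M) = minvsqrt M * N * minvsqrt M := by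
  have hscale : (Real.sqrt c)⁻¹ * (c * (Real.sqrt c)⁻¹) = 1 := by
    field_simp
    exact (Real.sq_sqrt hc.le).symm
  simp only [minvsqrt_smul hc.le hM, Matrix.smul_mul, Matrix.mul_smul, smul_smul, hscale,
    one_smul]

theorem twirlOp_conj_petzPartialTrace (s : Equiv.Perm A × (A → ℤˣ)) {c : ℝ} (hc : 0 < c)
    {σ : Matrix (A × B) (A × B) ℂ} (hσ : σ.IsHermitian) (Y : Matrix B B ℂ) :
    msqrt (twirlOp B s * σ * (twirlOp B s)ᴴ) * minvsqrt (c • ((1 : Matrix A A ℂ) ⊗ₖ trLeft σ)) *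
        (c • ((1 : Matrix A A ℂ) ⊗ₖ Y)) * minvsqrt (c • ((1 : Matrix A A ℂ) ⊗ₖ trLeft σ)) *
        msqrt (twirlOp B s * σ * (twirlOp B s)ᴴ) =
      twirlOp B s * petzPartialTrace σ Y * (twirlOp B s)ᴴ := by
  have hV := twirlOp_isometry (B := B) s
  have hσB := isHermitian_trLeft hσ
  set Z := minvsqrt (trLeft σ) * Y * minvsqrt (trLeft σ) with hZ
  have hK : minvsqrt ((1 : Matrix A A ℂ) ⊗ₖ trLeft σ) = 1 ⊗ₖ minvsqrt (trLeft σ) :=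
    cfc_one_kronecker hσB _
  have hmid : minvsqrt (c • ((1 : Matrix A A ℂ) ⊗ₖ trLeft σ)) * (c • ((1 : Matrix A A ℂ) ⊗ₖ Y)) *
      minvsqrt (c • ((1 : Matrix A A ℂ) ⊗ₖ trLeft σ)) = 1 ⊗ₖ Z := by
    rw [minvsqrt_smul_mul_smul_mul_minvsqrt_smul hc (isHermitian_one_kronecker hσB), hK, hZ,
      ← Matrix.mul_kronecker_mul, ← Matrix.mul_kronecker_mul, Matrix.mul_one, Matrix.mul_one]
  have hinv : (1 : Matrix A A ℂ) ⊗ₖ Z = twirlOp B s * (1 ⊗ₖ Z) * (twirlOp B s)ᴴ := by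
    rw [twirlOp_mul_one_kronecker, Matrix.mul_assoc, mul_eq_one_comm.1 hV, Matrix.mul_one]
  calc _ = msqrt (twirlOp B s * σ * (twirlOp B s)ᴴ) * (1 ⊗ₖ Z) *
        msqrt (twirlOp B s * σ * (twirlOp B s)ᴴ) := by rw [← hmid]; simp only [Matrix.mul_assoc]
    _ = twirlOp B s * petzPartialTrace σ Y * (twirlOp B s)ᴴ := by
      rw [msqrt_conj_isometry hV hσ, hinv, conj_isometry_mul_conj_isometry hV,
        conj_isometry_mul_conj_isometry hV, petzPartialTrace]

theorem umegaki_inv_card_smul_one_kronecker [Nonempty A] {ρ σ : Matrix B B ℂ}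
    (hρ : ρ.IsHermitian) (hσ : σ.PosDef) :
    umegaki ((Fintype.card A : ℝ)⁻¹ • ((1 : Matrix A A ℂ) ⊗ₖ ρ))
      ((Fintype.card A : ℝ)⁻¹ • ((1 : Matrix A A ℂ) ⊗ₖ σ)) = umegaki ρ σ := by
  have hA : (Fintype.card A : ℝ) ≠ 0 := Nat.cast_ne_zero.2 Fintype.card_ne_zero
  have hσA : ((1 : Matrix A A ℂ) ⊗ₖ σ).PosDef := Matrix.PosDef.one.kronecker hσ
  rw [umegaki_smul_smul _ (isHermitian_one_kronecker hρ) hσA.1 (supp_le_supp_of_posDef _ hσA),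
    one_kronecker_eq_blockOp, one_kronecker_eq_blockOp,
    umegaki_blockOp _ (fun _ => hρ) (fun _ => hσ.1), Finset.sum_const, Finset.card_univ,
    nsmul_eq_mul, inv_mul_cancel_left₀ hA]

theorem JointConvexity.monotonicityPartialTrace (h : JointConvexity.{u}) :
    MonotonicityPartialTrace.{u} := by
  intro A B _ _ _ _ ρ σ hρ hσ hsupp hpos
  have : Nonempty A := hρ.nonempty.map Prod.fst
  have hc : (0 : ℝ) < (Fintype.card A : ℝ)⁻¹ := by positivity
  have hσA : ((Fintype.card A : ℝ)⁻¹ • ((1 : Matrix A A ℂ) ⊗ₖ trLeft σ)).PosDef :=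
    (Matrix.PosDef.one.kronecker hpos).smul hc
  let p (_ : Equiv.Perm A × (A → ℤˣ)) : ℝ := (Fintype.card (Equiv.Perm A × (A → ℤˣ)) : ℝ)⁻¹
  have hp : IsProb p := ⟨fun _ => by positivity, by
    rw [Finset.sum_const, Finset.card_univ, nsmul_eq_mul, mul_inv_cancel₀ (by positivity)]⟩
  have hV := twirlOp_isometry (A := A) (B := B)
  have hsuppV (s) := supp_conj_le_supp_conj (hV s) hsupp
  have key := h _ (A × B) p (fun s => twirlOp B s * ρ * (twirlOp B s)ᴴ)
    (fun s => twirlOp B s * σ * (twirlOp B s)ᴴ) hp (fun s => hρ.conj_isometry (hV s))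
    (fun s => hσ.conj_isometry (hV s)) hsuppV (by simpa only [p, average_twirl] using hσA)
  have hρB := isHermitian_trLeft hρ.1.1
  simp only [p, average_twirl, twirlOp_conj_petzPartialTrace _ hc hσ.1.1,
    buresSq_conj_isometry (hV _) hρ.1.1 (isHermitian_petzPartialTrace σ hρB),
    relEntropy_eq (hsuppV _), umegaki_conj_isometry (hV _) hρ.1.1 hσ.1.1,
    relEntropy_eq (supp_le_supp_of_posDef _ hσA), umegaki_inv_card_smul_one_kronecker hρB hpos,
    ← EReal.coe_mul, ← ereal_coe_sum, ← Finset.sum_mul] at key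
  rw [show ∑ s, p s = 1 from hp.2, one_mul, one_mul] at key
  rwa [relEntropy_eq hsupp, relEntropy_eq (supp_le_supp_of_posDef _ hpos)]

end JointConvexity

section Dilation

variable {S B E : Type u} [Fintype S] [DecidableEq S] [Fintype E]

theorem trLeft_conjTranspose {A : Type u} [Fintype A] (M : Matrix (A × B) (A × B) ℂ) :
    trLeft Mᴴ = (trLeft M)ᴴ := by
  ext; simp [trLeft]

theorem hsAdjoint_of_dilation [Fintype B] [DecidableEq E] {N : Matrix S S ℂ →ₗ[ℂ] Matrix B B ℂ}
    {V : Matrix (E × B) S ℂ} (hN : ∀ M, N M = trLeft (V * M * Vᴴ)) (Y : Matrix B B ℂ) :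
    hsAdjoint N Y = Vᴴ * ((1 : Matrix E E ℂ) ⊗ₖ Y) * V := by
  refine Matrix.ext_iff_trace_mul_left.2 fun X => ?_
  obtain ⟨X, rfl⟩ : ∃ Z, X = Zᴴ := ⟨Xᴴ, X.conjTranspose_conjTranspose.symm⟩
  calc (Xᴴ * hsAdjoint N Y).trace = (trLeft (V * X * Vᴴ)ᴴ * Y).trace := by
        rw [trace_mul_hsAdjoint, hN, trLeft_conjTranspose]
    _ = (V * (Xᴴ * (Vᴴ * ((1 : Matrix E E ℂ) ⊗ₖ Y)))).trace := by
        rw [← trLeft_mul_one_kronecker, trace_trLeft]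
        simp only [Matrix.conjTranspose_mul, Matrix.conjTranspose_conjTranspose, Matrix.mul_assoc]
    _ = (Xᴴ * (Vᴴ * ((1 : Matrix E E ℂ) ⊗ₖ Y) * V)).trace := by
        rw [Matrix.trace_mul_comm]
        simp only [Matrix.mul_assoc]

theorem isometry_of_dilation [Fintype B] {N : Matrix S S ℂ →ₗ[ℂ] Matrix B B ℂ}
    {V : Matrix (E × B) S ℂ} (hN : ∀ M, N M = trLeft (V * M * Vᴴ))
    (htr : ∀ M, (N M).trace = M.trace) : Vᴴ * V = 1 := by
  refine Matrix.ext_iff_trace_mul_right.2 fun M => ?_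
  rw [Matrix.mul_assoc, Matrix.trace_mul_comm, ← trace_trLeft, ← hN, htr, Matrix.one_mul]

/-- The Choi matrix of a linear map `N`, whose `(i, j)` block is `N E_ij` for the matrix unit
`E_ij`. It is positive semidefinite when `N` is completely positive, which yields the Kraus
operators of `N`. -/
def choiMatrix (N : Matrix S S ℂ →ₗ[ℂ] Matrix B B ℂ) : Matrix (S × B) (S × B) ℂ :=
  Matrix.of fun x y => N (Matrix.single x.1 y.1 1) x.2 y.2

theorem apply_eq_sum_choiMatrix (N : Matrix S S ℂ →ₗ[ℂ] Matrix B B ℂ) (M : Matrix S S ℂ)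
    (b b' : B) : N M b b' = ∑ s, ∑ t, M s t * choiMatrix N (s, b) (t, b') := by
  have hsingle (s t) : Matrix.single s t (M s t) = M s t • Matrix.single s t (1 : ℂ) := by
    rw [Matrix.smul_single, smul_eq_mul, mul_one]
  conv_lhs => rw [Matrix.matrix_eq_sum_single M]
  simp only [hsingle, map_sum, map_smul, Matrix.sum_apply, Matrix.smul_apply, smul_eq_mul]
  rfl

theorem IsCPTP.posSemidef_choiMatrix [Fintype B] {N : Matrix S S ℂ →ₗ[ℂ] Matrix B B ℂ}
    (hN : IsCPTP N) : (choiMatrix N).PosSemidef := by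
  let e := Fintype.equivFin S
  let v : Fin (Fintype.card S) × S → ℂ := fun x => if e.symm x.1 = x.2 then 1 else 0
  have hsingle (i j) : Matrix.single i j (1 : ℂ) = Matrix.of fun s s' =>
      Matrix.vecMulVec v (star v) (e i, s) (e j, s') := by
    ext s t
    simp only [v, Matrix.vecMulVec_apply, Matrix.single_apply, Matrix.of_apply,
      Equiv.symm_apply_apply, Pi.star_apply]
    split_ifs <;> simp_all
  have hchoi : choiMatrix N = (ampliate N _ (Matrix.vecMulVec v (star v))).submatrix
      (Prod.map e id) (Prod.map e id) := by
    ext x y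
    simp only [choiMatrix, Matrix.of_apply, hsingle]
    rfl
  rw [hchoi]
  exact (hN.completelyPositive _ _ (Matrix.posSemidef_vecMulVec_self_star v)).submatrix _

variable [Fintype B]

/-- The operator `S → (S ⊗ B) ⊗ B` whose blocks are the Kraus operators of `N` read off from the
rows of the square root of its Choi matrix. -/
def krausDilation [DecidableEq B] (N : Matrix S S ℂ →ₗ[ℂ] Matrix B B ℂ) :
    Matrix ((S × B) × B) S ℂ :=
  Matrix.of fun x s => star (msqrt (choiMatrix N) x.1 (s, x.2))

theorem trLeft_krausDilation_conj_apply [DecidableEq B] (N : Matrix S S ℂ →ₗ[ℂ] Matrix B B ℂ)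
    (M : Matrix S S ℂ) (b b' : B) : trLeft (krausDilation N * M * (krausDilation N)ᴴ) b b' =
      ∑ s, ∑ t, M s t * (msqrt (choiMatrix N) * msqrt (choiMatrix N)) (s, b) (t, b') := by
  have hherm (x y) : star (msqrt (choiMatrix N) x y) = msqrt (choiMatrix N) y x :=
    (isHermitian_msqrt (choiMatrix N)).apply y x
  simp only [trLeft, krausDilation, Matrix.of_apply, Matrix.mul_apply, Matrix.conjTranspose_apply,
    hherm, Finset.sum_mul, Finset.mul_sum]
  rw [Finset.sum_comm]
  conv_rhs => rw [Finset.sum_comm]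
  refine Finset.sum_congr rfl fun t _ => ?_
  rw [Finset.sum_comm]
  refine Finset.sum_congr rfl fun s _ => Finset.sum_congr rfl fun z _ => ?_
  ring

theorem IsCPTP.exists_dilation {N : Matrix S S ℂ →ₗ[ℂ] Matrix B B ℂ} (hN : IsCPTP N) :
    ∃ V : Matrix ((S × B) × B) S ℂ, Vᴴ * V = 1 ∧ ∀ M, N M = trLeft (V * M * Vᴴ) := by
  classical
  have hV (M) : N M = trLeft (krausDilation N * M * (krausDilation N)ᴴ) := by
    ext b b'
    rw [trLeft_krausDilation_conj_apply, msqrt_mul_self hN.posSemidef_choiMatrix,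
      apply_eq_sum_choiMatrix]
  exact ⟨krausDilation N, isometry_of_dilation hV hN.tracePreserving, hV⟩

theorem isCPTP_trLeftLinearMap (A B : Type u) [Fintype A] [Fintype B] :
    IsCPTP (trLeftLinearMap A B) where
  completelyPositive k M hM := by
    have hsum : ampliate (trLeftLinearMap A B) k M =
        ∑ a : A, M.submatrix (fun x : Fin k × B => (x.1, a, x.2)) fun x => (x.1, a, x.2) := by
      ext x y
      simp [ampliate, trLeftLinearMap, trLeft, Matrix.sum_apply]
    rw [hsum]
    exact Matrix.posSemidef_sum _ fun a _ => hM.submatrix _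
  tracePreserving := trace_trLeft

theorem MonotonicityChannel.monotonicityPartialTrace (h : MonotonicityChannel.{u}) :
    MonotonicityPartialTrace.{u} := by
  intro A B _ _ _ _ ρ σ hρ hσ hsupp hpos
  have hdil (M) : trLeftLinearMap A B M = trLeft (1 * M * (1 : Matrix (A × B) (A × B) ℂ)ᴴ) := by
    rw [Matrix.conjTranspose_one, Matrix.one_mul, Matrix.mul_one]
    rfl
  have key := h (A × B) B ρ σ (trLeftLinearMap A B) hρ hσ hsupp (isCPTP_trLeftLinearMap A B) hpos
  rw [petz, hsAdjoint_of_dilation hdil, Matrix.conjTranspose_one, Matrix.one_mul,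
    Matrix.mul_one] at key
  exact key

theorem petzPartialTrace_dilation [DecidableEq B] [DecidableEq E]
    {N : Matrix S S ℂ →ₗ[ℂ] Matrix B B ℂ}
    {V : Matrix (E × B) S ℂ} (hV : Vᴴ * V = 1) (hN : ∀ M, N M = trLeft (V * M * Vᴴ))
    {σ : Matrix S S ℂ} (hσ : σ.IsHermitian) (Y : Matrix B B ℂ) :
    petzPartialTrace (V * σ * Vᴴ) Y = V * petz σ N Y * Vᴴ := by
  rw [petzPartialTrace, petz, ← hN, msqrt_conj_isometry hV hσ, hsAdjoint_of_dilation hN]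
  simp only [Matrix.mul_assoc]

theorem isHermitian_petz_of_dilation [DecidableEq B] {N : Matrix S S ℂ →ₗ[ℂ] Matrix B B ℂ}
    {V : Matrix (E × B) S ℂ} (hN : ∀ M, N M = trLeft (V * M * Vᴴ)) (σ : Matrix S S ℂ)
    {Y : Matrix B B ℂ} (hY : Y.IsHermitian) : (petz σ N Y).IsHermitian := by
  classical
  rw [petz, hsAdjoint_of_dilation hN]
  exact isHermitian_mul_mul_self (isHermitian_msqrt σ) <|
    Matrix.isHermitian_conjTranspose_mul_mul V <| isHermitian_one_kronecker <|
      isHermitian_mul_mul_self (isHermitian_minvsqrt _) hY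

theorem MonotonicityPartialTrace.monotonicityChannel (h : MonotonicityPartialTrace.{u}) :
    MonotonicityChannel.{u} := by
  intro S B _ _ _ _ ρ σ N hρ hσ hsupp hN hpos
  obtain ⟨V, hV, hNV⟩ := hN.exists_dilation
  have hsuppV := supp_conj_le_supp_conj hV hsupp
  have hNρ : (N ρ).IsHermitian := by
    rw [hNV]
    exact isHermitian_trLeft (hρ.conj_isometry hV).1.1
  have key := h _ B _ _ (hρ.conj_isometry hV) (hσ.conj_isometry hV) hsuppV (by rwa [← hNV])
  rwa [← hNV, ← hNV, petzPartialTrace_dilation hV hNV hσ.1.1,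
    buresSq_conj_isometry hV hρ.1.1 (isHermitian_petz_of_dilation hNV σ hNρ),
    relEntropy_eq hsuppV, umegaki_conj_isometry hV hρ.1.1 hσ.1.1, ← relEntropy_eq hsupp] at key

end Dilation

section Monotonicity

open Filter Topology

variable {A B : Type u} [Fintype A]

theorem trLeft_lineMap (σ ρ : Matrix (A × B) (A × B) ℂ) (t : ℝ) :
    trLeft (AffineMap.lineMap σ ρ t) = AffineMap.lineMap (trLeft σ) (trLeft ρ) t := by
  simp only [AffineMap.lineMap_apply_module, ← trLeft_smul]
  exact map_add (trLeftLinearMap A B) _ _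

theorem IsDensity.lineMap {n : Type u} [Fintype n] {σ ρ : Matrix n n ℂ} (hσ : IsDensity σ)
    (hρ : IsDensity ρ) {t : ℝ} (h0 : 0 ≤ t) (h1 : t ≤ 1) :
    IsDensity (AffineMap.lineMap σ ρ t) := by
  rw [AffineMap.lineMap_apply_module]
  refine ⟨(hσ.1.smul (sub_nonneg.2 h1)).add (hρ.1.smul h0), ?_⟩
  rw [Matrix.trace_add, Matrix.trace_smul, Matrix.trace_smul, hσ.2, hρ.2, ← add_smul,
    sub_add_cancel, one_smul]

variable [DecidableEq A] [Fintype B] [DecidableEq B]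

theorem isDensity_petzPartialTrace {σ : Matrix (A × B) (A × B) ℂ} {ρ : Matrix B B ℂ}
    (hσ : σ.PosSemidef) (hpos : (trLeft σ).PosDef) (hρ : IsDensity ρ) :
    IsDensity (petzPartialTrace σ ρ) := by
  set K := minvsqrt (trLeft σ)
  have hK : K.IsHermitian := isHermitian_minvsqrt _
  have hinv : K * trLeft σ * K = 1 := by
    rw [minvsqrt_mul_mul_minvsqrt hpos.posSemidef, kerProj_of_posDef hpos, sub_zero]
  have hKρK : (K * ρ * K).PosSemidef := by
    simpa only [hK.eq] using hρ.1.mul_mul_conjTranspose_same K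
  constructor
  · simpa only [petzPartialTrace, (isHermitian_msqrt σ).eq] using
      (Matrix.PosSemidef.one.kronecker hKρK).mul_mul_conjTranspose_same (msqrt σ)
  calc (petzPartialTrace σ ρ).trace = (msqrt σ * msqrt σ * (1 ⊗ₖ (K * ρ * K))).trace := by
        rw [petzPartialTrace, Matrix.trace_mul_comm, ← Matrix.mul_assoc]
    _ = (trLeft σ * (K * ρ * K)).trace := by
        rw [msqrt_mul_self hσ, ← trLeft_mul_one_kronecker, trace_trLeft]
    _ = (K * trLeft σ * K * ρ).trace := by
        rw [← Matrix.mul_assoc, Matrix.trace_mul_comm]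
        simp only [Matrix.mul_assoc]
    _ = 1 := by rw [hinv, Matrix.one_mul, hρ.2]

theorem ConcavityCondEntropy.mul_buresSq_add_le (h : ConcavityCondEntropy.{u})
    {σ ρ τ : Matrix (A × B) (A × B) ℂ} (hσ : IsDensity σ) (hρ : IsDensity ρ) {t : ℝ}
    (h0 : 0 ≤ t) (h1 : t ≤ 1) (hτ : AffineMap.lineMap σ ρ t = τ) (hpos : (trLeft τ).PosDef) :
    (1 - t) * buresSq σ (petzPartialTrace τ (trLeft σ)) +
        t * buresSq ρ (petzPartialTrace τ (trLeft ρ)) ≤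
      (1 - t) * (umegaki σ τ - umegaki (trLeft σ) (trLeft τ)) +
        t * (umegaki ρ τ - umegaki (trLeft ρ) (trLeft τ)) := by
  let p : PUnit.{u + 1} ⊕ PUnit.{u + 1} → ℝ := Sum.elim (fun _ => 1 - t) fun _ => t
  let ν : PUnit.{u + 1} ⊕ PUnit.{u + 1} → Matrix (A × B) (A × B) ℂ :=
    Sum.elim (fun _ => σ) fun _ => ρ
  have hp : IsProb p :=
    ⟨by rintro (_ | _); exacts [sub_nonneg.2 h1, h0], by simp [p]⟩
  have hν (i) : IsDensity (ν i) := by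
    rcases i with _ | _
    exacts [hσ, hρ]
  have hmix : ∑ i, p i • ν i = τ := by
    rw [← hτ, AffineMap.lineMap_apply_module]
    simp [p, ν]
  have key := h _ A B p ν hp hν (hmix ▸ hpos)
  rw [condEntropy_sub_sum_condEntropy hp hν, hmix, EReal.coe_le_coe_iff,
    ← Finset.sum_sub_distrib] at key
  simpa only [p, ν, Fintype.sum_sum_type, Sum.elim_inl, Sum.elim_inr, Finset.univ_unique,
    Finset.sum_singleton, mul_sub] using key

theorem ConcavityCondEntropy.buresSq_le_umegaki_lineMap_sub (h : ConcavityCondEntropy.{u})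
    {σ ρ : Matrix (A × B) (A × B) ℂ} (hσ : IsDensity σ) (hρ : IsDensity ρ)
    (hsupp : supp ρ ≤ supp σ) (hpos : (trLeft σ).PosDef) {t : ℝ} (h0 : 0 < t) (h1 : t < 1) :
    buresSq ρ (petzPartialTrace (AffineMap.lineMap σ ρ t) (trLeft ρ)) ≤
      umegaki ρ (AffineMap.lineMap σ ρ t) -
        umegaki (trLeft ρ) (AffineMap.lineMap (trLeft σ) (trLeft ρ) t) +
      (1 - t) * (σ * (σ - ρ) * pinv (AffineMap.lineMap σ ρ t + kerProj σ)).trace.re := by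
  have hσB := isDensity_trLeft hσ
  have hτ := hσ.lineMap hρ h0.le h1.le
  have hχ := umegaki_lineMap_le hσ.1 hρ.1 hsupp h0.le h1
  set τ : Matrix (A × B) (A × B) ℂ := AffineMap.lineMap σ ρ t with hτ_def
  have hτB : trLeft τ = AffineMap.lineMap (trLeft σ) (trLeft ρ) t := trLeft_lineMap σ ρ t
  have hτBpos : (trLeft τ).PosDef :=
    hτB ▸ posDef_lineMap hpos (posSemidef_trLeft hρ.1) h0.le h1
  have hmix := h.mul_buresSq_add_le hσ hρ h0.le h1.le hτ_def.symm hτBpos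
  have hbures := buresSq_nonneg hσ (isDensity_petzPartialTrace hτ.1 hτBpos hσB)
  have hklein : 0 ≤ umegaki (trLeft σ) (trLeft τ) := by
    simpa only [hσB.2, (isDensity_trLeft hτ).2, sub_self] using
      trace_sub_trace_le_umegaki hσB.1 hτBpos
  have h1t : 0 ≤ 1 - t := (sub_pos.2 h1).le
  have hbures_mul := mul_nonneg h1t hbures
  have hχ_mul := mul_le_mul_of_nonneg_left ((sub_le_self _ hklein).trans hχ) h1t
  rw [← hτB]
  refine le_of_mul_le_mul_left ?_ h0
  linarith

theorem ConcavityCondEntropy.monotonicityPartialTrace (h : ConcavityCondEntropy.{u}) :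
    MonotonicityPartialTrace.{u} := by
  intro A B _ _ _ _ ρ σ hρ hσ hsupp hpos
  have hsuppB := supp_le_supp_of_posDef (trLeft ρ) hpos
  have hρB := isHermitian_trLeft hρ.1.1
  rw [relEntropy_sub_relEntropy hsupp hsuppB, EReal.coe_le_coe_iff]
  have hbures := tendsto_buresSq ρ
    (tendsto_petzPartialTrace (tendsto_lineMap σ ρ) (isHermitian_lineMap hσ.1.1 hρ.1.1) hσ.1.1
      hpos (trLeft ρ))
    (fun _ => isHermitian_petzPartialTrace _ hρB) (isHermitian_petzPartialTrace _ hρB)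
  have hD := tendsto_umegaki_right ρ (tendsto_mlog_lineMap hσ.1 hρ.1.1 hsupp)
  have hDB := tendsto_umegaki_right (trLeft ρ) (tendsto_mlog_lineMap hpos.posSemidef hρB hsuppB)
  have hweight : Tendsto (fun t : ℝ => 1 - t) (𝓝[>] 0) (𝓝 1) :=
    ((continuous_const.sub continuous_id).tendsto' 0 1 (sub_zero 1)).mono_left nhdsWithin_le_nhds
  have hχ := tendsto_trace_mul_pinv_lineMap hσ.1 hρ.1.1 hsupp (hσ.2.trans hρ.2.symm)
  have hbound := (hD.sub hDB).add (hweight.mul hχ)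
  rw [mul_zero, add_zero] at hbound
  refine le_of_tendsto_of_tendsto hbures hbound ?_
  filter_upwards [Ioo_mem_nhdsGT (zero_lt_one' ℝ)] with t ht
  exact h.buresSq_le_umegaki_lineMap_sub hσ hρ hsupp hpos ht.1 ht.2

end Monotonicity

end

end PetzRemainder

theorem mainTheorem3 :
    List.TFAE [
      PetzRemainder.StrongSubadditivity.{u},
      PetzRemainder.ConcavityCondEntropy.{u},
      PetzRemainder.MonotonicityPartialTrace.{u},
      PetzRemainder.JointConvexity.{u},
      PetzRemainder.MonotonicityChannel.{u}] := by
  tfae_have 1 → 2 := fun h => h.concavityCondEntropy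
  tfae_have 2 → 3 := fun h => h.monotonicityPartialTrace
  tfae_have 3 → 1 := fun h => h.strongSubadditivity
  tfae_have 3 → 4 := fun h => h.jointConvexity
  tfae_have 4 → 3 := fun h => h.monotonicityPartialTrace
  tfae_have 3 → 5 := fun h => h.monotonicityChannel
  tfae_have 5 → 3 := fun h => h.monotonicityPartialTrace
  tfae_finish
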